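/- Let $f:\mathbb{C}\to\mathbf{P}^n$ be a holomorphic curve with a reduced homogeneous representation $f=(f_0:\dots:f_n)$, that is, $f_0,\dots,f_n$ are entire functions without common zeros, and put $\|f\|=\sqrt{|f_0|^2+\dots+|f_n|^2}$. Assume that $f$ is linearly non-degenerate, i.e. that $f_0,\dots,f_n$ are linearly independent over $\mathbb{C}$. Let $$T(r,f)=\frac1{2\pi}\int_{-\pi}^{\pi}\log\|f(re^{i\theta})\|\,d\theta-\log\|f(0)\|$$ be the Cartan–Nevanlinna characteristic, and let $$N_1(r,f)=\int_0^r\bigl(n_1(t)-n_1(0)\bigr)\frac{dt}{t}+n_1(0)\log r ,$$ where $n_1(t)$ is the number of zeros, counted with multiplicity, of the Wronskian $W(f_0,\dots,f_n)$ in the disc $|z|\le t$. Let $A$ be a finite set of hyperplanes in $\mathbf{P}^n$. The flats generated by $A$ are the intersections of subsets of $A$ (the empty set has codimension $n+1$). Assume that $A$ is complete, i.e. that the empty set is one of these flats; equivalently, the defining vectors of the hyperplanes in $A$ span $\mathbb{C}^{n+1}$. No general-position assumption is made on $A$. Let $\mathrm{dist}$ be the chordal distance on $\mathbf{P}^n$,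 $\mathrm{dist}(p,q)=\sqrt{1-|\langle p,q\rangle|^2/(\|p\|^2\|q\|^2)}$ in homogeneous coordinates. For $1\le k\le n$ and $w\in\mathbf{P}^n$ let $d_k(w)$ be the shortest distance from $w$ to a flat of codimension $k$ generated by $A$, and let $$m_k(r,f)=\frac1{2\pi}\int_{-\pi}^{\pi}\log\frac1{d_k(f(re^{it}))}\,dt .$$ Then these integrals converge for all $r>0$, and there are a function $S(r,f)$ and a set $E\subset\mathbb{R}$ of finite Lebesgue measure such that $$\sum_{k=1}^n m_k(r,f)+N_1(r,f)\le (n+1)T(r,f)+S(r,f)\qquad\text{for all } r>0,$$ and $S(r,f)=o(T(r,f))$ as $r\to\infty$, $r\notin E$. -/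

import Mathlib

open Filter Asymptotics MeasureTheory

noncomputable section

namespace HoloCurve

/-- The space `ℂ^{n+1}` of homogeneous coordinates, with its Hermitian norm. -/
abbrev HomCoord (n : ℕ) : Type := EuclideanSpace ℂ (Fin (n + 1))

/-- Complex projective space `ℙⁿ`. -/
abbrev ProjSpace (n : ℕ) : Type := Projectivization ℂ (HomCoord n)

/-- The chordal distance on `ℙⁿ`, normalized to have diameter at most `1`: the sine of the angle
between the two complex lines. -/
def chordalDist {n : ℕ} (p q : ProjSpace n) : ℝ :=
  Real.sqrt (1 - (‖inner ℂ p.rep q.rep‖ / (‖p.rep‖ * ‖q.rep‖)) ^ 2)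

/-- The chordal distance may be computed from arbitrary homogeneous coordinates. -/
theorem chordalDist_mk {n : ℕ} (v w : HomCoord n) (hv : v ≠ 0) (hw : w ≠ 0) :
    chordalDist (Projectivization.mk ℂ v hv) (Projectivization.mk ℂ w hw) =
      Real.sqrt (1 - (‖inner ℂ v w‖ / (‖v‖ * ‖w‖)) ^ 2) := by
  obtain ⟨a, ha⟩ := Projectivization.exists_smul_eq_mk_rep ℂ v hv
  obtain ⟨b, hb⟩ := Projectivization.exists_smul_eq_mk_rep ℂ w hw
  have ha0 : ‖(a : ℂ)‖ ≠ 0 := norm_ne_zero_iff.mpr a.ne_zero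
  have hb0 : ‖(b : ℂ)‖ ≠ 0 := norm_ne_zero_iff.mpr b.ne_zero
  have hv0 : ‖v‖ ≠ 0 := norm_ne_zero_iff.mpr hv
  have hw0 : ‖w‖ ≠ 0 := norm_ne_zero_iff.mpr hw
  unfold chordalDist
  rw [← ha, ← hb]
  simp only [Units.smul_def, inner_smul_left, inner_smul_right, norm_mul, norm_smul,
    RCLike.norm_conj]
  congr 3
  field_simp

/-- The points of `ℙⁿ` lying on the projective subspace defined by a linear subspace of
`ℂ^{n+1}`. -/
def points {n : ℕ} (x : Submodule ℂ (HomCoord n)) : Set (ProjSpace n) :=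
  {p | p.submodule ≤ x}

/-- The distance from a point to the projective subspace defined by `x`
(meaningful if `x ≠ ⊥`). -/
def distTo {n : ℕ} (w : ProjSpace n) (x : Submodule ℂ (HomCoord n)) : ℝ :=
  sInf (chordalDist w '' points x)

/-- The codimension of a projective subspace in `ℙⁿ`; it equals `n + 1` exactly for the empty
projective subspace `x = ⊥`. -/
def codim {n : ℕ} (x : Submodule ℂ (HomCoord n)) : ℕ :=
  Module.finrank ℂ (HomCoord n ⧸ x)

/-- The flats generated by a finite set `A` of hyperplanes: all intersections of members
of `A`. -/
def flats {n : ℕ} (A : Finset (Submodule ℂ (HomCoord n))) : Set (Submodule ℂ (HomCoord n)) :=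
  {x | ∃ B ⊆ A, x = sInf (B : Set (Submodule ℂ (HomCoord n)))}

/-- A finite set of hyperplanes is complete if the empty projective subspace is one of its
flats. -/
def IsComplete {n : ℕ} (A : Finset (Submodule ℂ (HomCoord n))) : Prop :=
  ⊥ ∈ flats A

/-- `flatDist A k w` is the shortest distance from `w` to a flat of codimension `k` generated
by `A` (for `1 ≤ k ≤ n` and complete `A`). -/
def flatDist {n : ℕ} (A : Finset (Submodule ℂ (HomCoord n))) (k : ℕ) (w : ProjSpace n) : ℝ :=
  sInf (distTo w '' {x | x ∈ flats A ∧ codim x = k})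

/-- The `k`-proximity function of a curve `f` with respect to `A`. -/
def flatProximity {n : ℕ} (A : Finset (Submodule ℂ (HomCoord n))) (k : ℕ) (f : ℂ → ProjSpace n)
    (r : ℝ) : ℝ :=
  Real.circleAverage (fun z => Real.log (1 / flatDist A k (f z))) 0 r

/-- `F` is a reduced homogeneous representation of the curve `f`: its coordinates are entire
functions without common zeros, and `f z` has the homogeneous coordinates `F z`. -/
structure IsReducedRepresentation {n : ℕ} (f : ℂ → ProjSpace n) (F : ℂ → HomCoord n) : Prop where
  entire : ∀ j, Differentiable ℂ (fun z => F z j)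
  no_common_zero : ∀ z, F z ≠ 0
  eq_mk : ∀ z, f z = Projectivization.mk ℂ (F z) (no_common_zero z)

/-- Linear non-degeneracy: the coordinate functions are linearly independent over `ℂ`. -/
def LinearlyNondegenerate {n : ℕ} (F : ℂ → HomCoord n) : Prop :=
  LinearIndependent ℂ (fun (j : Fin (n + 1)) (z : ℂ) => F z j)

/-- The Cartan–Nevanlinna characteristic. -/
def characteristic {n : ℕ} (F : ℂ → HomCoord n) (r : ℝ) : ℝ :=
  Real.circleAverage (fun z => Real.log ‖F z‖) 0 r - Real.log ‖F 0‖

/-- The Wronskian determinant of the coordinate functions. -/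
def wronskian {n : ℕ} (F : ℂ → HomCoord n) (z : ℂ) : ℂ :=
  (Matrix.of fun i j : Fin (n + 1) => iteratedDeriv (i : ℕ) (fun w => F w j) z).det

/-- The Nevanlinna counting function of the zeros of the Wronskian, with multiplicity. -/
def ramificationCounting {n : ℕ} (F : ℂ → HomCoord n) (r : ℝ) : ℝ :=
  ValueDistribution.logCounting (wronskian F) 0 r

end HoloCurve

end

namespace HoloCurve

/-! ### Distances to flats -/

/-! The argument is Cartan's, with general position replaced by a greedy choice of basis at each
point. Let `ν a` be unit normals of the hyperplanes and `g_a = ⟨ν a, F⟩`. At a point `z` where no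
`g_a` vanishes, choose hyperplanes `b_0, …, b_n` one after another, each minimizing `|g_a(z)|` among
those whose normal is independent of the earlier ones; completeness guarantees `n + 1` choices. A
flat of codimension `i + 1` is cut out by hyperplanes whose normals have rank `i + 1`, so one of
them, `c`, competes with `b_i`. Hence `|g_{b_i}| ≤ |g_c| ≤ ‖F‖ · dist`, which bounds `log (1 /
d_{i+1})` by `log (‖F‖ / |g_{b_i}|)`. Summation over the codimensions is
`exists_basis_sum_log_flatDist_le`.

The Wronskian of `g_{b_0}, …, g_{b_n}` is a nonzero constant times `W(F)`, and its quotient by `∏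
g_{b_i}` is a determinant of logarithmic derivatives. Hence `∑ log (1 / d_k) + log |W| ≤ (n + 1) log
‖F‖` up to a constant and a term built from logarithmic derivatives (`log_wronskian_le`). There are
finitely many bases, so the constant does not depend on `z`. Averaging over circles and Jensen's
formula for `W` give the theorem, once the logarithmic derivatives are shown to be negligible.

The lemma on the logarithmic derivative needs functions with characteristic at most `T(r, f) +
O(1)`, which the `g_a` need not be. Therefore all `g_a` are divided by one fixed linear form `φ` of
`F`; this multiplies the Wronskian by a power of `φ` and leaves the quotient estimate unchanged. For
such a quotient `h`, split off the zeros and poles in a disc, use the Poisson formula for the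
zero-free factor, find a small circle about `z` on which `|h| ≤ e |h(z)|`, and apply Cauchy's
estimate. Concavity of the logarithm turns this into a bound on the average
(`exists_circleAverage_posLog_iteratedDeriv_le`), and Borel's growth lemma makes it `O(log r + log
T)` outside a set of finite measure. When `log r` is not negligible against the sum of the
characteristics of the quotients, convexity in `log r` forces that sum to be `O(log r)`, and other
radii give a bounded error. -/

theorem distTo_mk {n : ℕ} (v : HomCoord n) (hv : v ≠ 0) (x : Submodule ℂ (HomCoord n))
    (hx : x ≠ ⊥) :
    distTo (Projectivization.mk ℂ v hv) x = ‖xᗮ.starProjection v‖ / ‖v‖ := by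
  have hv0 : 0 < ‖v‖ := norm_pos_iff.mpr hv
  have hpyth := Submodule.norm_sq_eq_add_norm_sq_starProjection v x
  have hsq : (‖xᗮ.starProjection v‖ / ‖v‖) ^ 2 = 1 - (‖x.starProjection v‖ / ‖v‖) ^ 2 := by
    field_simp
    linarith
  have hform : ‖xᗮ.starProjection v‖ / ‖v‖ = Real.sqrt (1 - (‖x.starProjection v‖ / ‖v‖) ^ 2) := by
    rw [← hsq, Real.sqrt_sq (by positivity)]
  have hinner : ∀ p ∈ x, inner ℂ v p = inner ℂ (x.starProjection v) p := by
    intro p hp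
    rw [Submodule.inner_starProjection_left_eq_right, Submodule.starProjection_eq_self_iff.mpr hp]
  refine IsLeast.csInf_eq ⟨?_, ?_⟩
  · have hex : ∃ p ∈ x, ∃ hp : p ≠ 0,
        chordalDist (Projectivization.mk ℂ v hv) (Projectivization.mk ℂ p hp) =
          ‖xᗮ.starProjection v‖ / ‖v‖ := by
      -- The nearest point is the projection of `v`. If that vanishes, `v` is orthogonal to `x` and
      -- every point of `x` is at distance `1`.
      by_cases h0 : x.starProjection v = 0
      · obtain ⟨p, hp, hp0⟩ := Submodule.exists_mem_ne_zero_of_ne_bot hx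
        refine ⟨p, hp, hp0, ?_⟩
        rw [chordalDist_mk, hform, hinner p hp, h0]
        simp
      · refine ⟨x.starProjection v, Submodule.starProjection_apply_mem x v, h0, ?_⟩
        rw [chordalDist_mk, hform, hinner _ (Submodule.starProjection_apply_mem x v)]
        have : ‖x.starProjection v‖ ≠ 0 := norm_ne_zero_iff.mpr h0
        congr 3
        rw [inner_self_eq_norm_sq_to_K]
        simp only [norm_pow, Complex.coe_algebraMap, Complex.norm_real, norm_norm]
        field_simp
    obtain ⟨p, hp, hp0, hd⟩ := hex
    refine ⟨Projectivization.mk ℂ p hp0, ?_, hd⟩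
    simpa [points, Projectivization.submodule_mk, Submodule.span_le] using hp
  · rintro _ ⟨q, hq, rfl⟩
    induction q using Projectivization.ind with
    | h p hp0 =>
      have hp : p ∈ x := by
        simpa [points, Projectivization.submodule_mk, Submodule.span_le] using hq
      rw [chordalDist_mk, hform, hinner p hp]
      apply Real.sqrt_le_sqrt
      have hp1 : 0 < ‖p‖ := norm_pos_iff.mpr hp0
      have hle : ‖inner ℂ (x.starProjection v) p‖ / (‖v‖ * ‖p‖) ≤ ‖x.starProjection v‖ / ‖v‖ := by
        rw [div_le_div_iff₀ (by positivity) hv0]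
        have := norm_inner_le_norm (𝕜 := ℂ) (x.starProjection v) p
        nlinarith
      gcongr

theorem flats_finite {n : ℕ} (A : Finset (Submodule ℂ (HomCoord n))) : (flats A).Finite := by
  refine ((A.powerset.finite_toSet).image fun B : Finset _ => sInf (B : Set (Submodule ℂ (HomCoord n)))).subset
    ?_
  rintro x ⟨B, hB, rfl⟩
  exact ⟨B, Finset.mem_coe.mpr (Finset.mem_powerset.mpr hB), rfl⟩

theorem ne_bot_of_codim_le {n : ℕ} {x : Submodule ℂ (HomCoord n)} (h : codim x ≤ n) : x ≠ ⊥ := by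
  rintro rfl
  unfold codim at h
  have := Submodule.finrank_quotient_add_finrank (⊥ : Submodule ℂ (HomCoord n))
  simp only [finrank_bot, add_zero, finrank_euclideanSpace, Fintype.card_fin] at this
  omega

variable {n : ℕ} {f : ℂ → ProjSpace n} {F : ℂ → HomCoord n}

theorem IsReducedRepresentation.differentiable (hF : IsReducedRepresentation f F) :
    Differentiable ℂ F := by
  rw [differentiable_euclidean]
  exact hF.entire

theorem IsReducedRepresentation.circleIntegrable_log_norm_comp (hF : IsReducedRepresentation f F)
    {E : Type*} [NormedAddCommGroup E] [NormedSpace ℂ E] (L : HomCoord n →L[ℂ] E) (r : ℝ) :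
    CircleIntegrable (fun z => Real.log ‖L (F z)‖) 0 r := by
  apply MeromorphicOn.circleIntegrable_log_norm
  intro z _
  have h1 : Differentiable ℂ (fun z => L (F z)) := L.differentiable.comp hF.differentiable
  by_cases hE : CompleteSpace E
  · exact (h1.analyticAt z).meromorphicAt
  · have h2 : AnalyticAt ℂ F z := hF.differentiable.analyticAt z
    exact ((L.analyticAt _).comp h2).meromorphicAt

theorem IsReducedRepresentation.distTo_eq (hF : IsReducedRepresentation f F)
    {x : Submodule ℂ (HomCoord n)} (hx : x ≠ ⊥) (z : ℂ) :
    distTo (f z) x = ‖xᗮ.starProjection (F z)‖ / ‖F z‖ := by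
  rw [hF.eq_mk z, distTo_mk _ _ _ hx]

theorem flatDist_mem {A : Finset (Submodule ℂ (HomCoord n))} {k : ℕ} (w : ProjSpace n)
    (hne : {x | x ∈ flats A ∧ codim x = k}.Nonempty) :
    ∃ x ∈ flats A, codim x = k ∧ flatDist A k w = distTo w x := by
  have hfin : {x | x ∈ flats A ∧ codim x = k}.Finite := (flats_finite A).subset fun x hx => hx.1
  obtain ⟨x, hx, h⟩ := (hne.image (distTo w)).csInf_mem (hfin.image _)
  exact ⟨x, hx.1, hx.2, h.symm⟩

/-- At each point the infimum is attained at one of finitely many flats, so its logarithm is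
dominated by a sum over all of them; each summand involves only log-norms of holomorphic vector
functions. -/
theorem IsReducedRepresentation.circleIntegrable_log_flatDist (hF : IsReducedRepresentation f F)
    (A : Finset (Submodule ℂ (HomCoord n))) {k : ℕ} (hk : k ≤ n) (r : ℝ) :
    CircleIntegrable (fun z => Real.log (1 / flatDist A k (f z))) 0 r := by
  classical
  rcases Set.eq_empty_or_nonempty {x | x ∈ flats A ∧ codim x = k} with he | hne
  -- With no flat of codimension `k` the integrand is `0`, since `sInf ∅ = 0` and `log (1 / 0) = 0`.
  · simp [flatDist, he]
  have hfin : {x | x ∈ flats A ∧ codim x = k}.Finite := (flats_finite A).subset fun x hx => hx.1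
  have hbot : ∀ x : {x | x ∈ flats A ∧ codim x = k}, (x : Submodule ℂ (HomCoord n)) ≠ ⊥ :=
    fun x => ne_bot_of_codim_le (x.2.2.le.trans hk)
  have hint : ∀ x : Submodule ℂ (HomCoord n), CircleIntegrable
      (fun z => |Real.log ‖xᗮ.starProjection (F z)‖| + |Real.log ‖F z‖|) 0 r := fun x =>
    (hF.circleIntegrable_log_norm_comp (xᗮ.starProjection) r).abs.add
      (hF.circleIntegrable_log_norm_comp (ContinuousLinearMap.id ℂ _) r).abs
  have hsum : CircleIntegrable (∑ x ∈ hfin.toFinset,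
      fun z => |Real.log ‖xᗮ.starProjection (F z)‖| + |Real.log ‖F z‖|) 0 r :=
    CircleIntegrable.sum _ fun x _ => hint x
  have hcont := hF.differentiable.continuous
  have hmeas : Measurable fun z => flatDist A k (f z) := by
    have : ∀ z, flatDist A k (f z) =
        ⨅ x : {x | x ∈ flats A ∧ codim x = k}, ‖(x : Submodule ℂ _)ᗮ.starProjection (F z)‖ / ‖F z‖ := by
      intro z
      unfold flatDist
      rw [sInf_image']
      exact iInf_congr fun x => hF.distTo_eq (hbot x) z
    simp_rw [this]
    have : Countable {x | x ∈ flats A ∧ codim x = k} := hfin.countable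
    refine Measurable.iInf fun x => Continuous.measurable ?_
    have := fun z => norm_ne_zero_iff.mpr (hF.no_common_zero z)
    fun_prop (disch := assumption)
  unfold CircleIntegrable at hsum ⊢
  refine hsum.mono_fun' ?_ ?_
  · apply Measurable.aestronglyMeasurable
    have := (continuous_circleMap (0 : ℂ) r).measurable
    exact Real.measurable_log.comp (measurable_const.div (hmeas.comp this))
  · refine Eventually.of_forall fun θ => ?_
    obtain ⟨x, hx, hxk, hd⟩ := flatDist_mem (f (circleMap 0 r θ)) hne
    have hxb : x ≠ ⊥ := ne_bot_of_codim_le (hxk.le.trans hk)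
    simp only [hd, hF.distTo_eq hxb, Finset.sum_apply]
    refine le_trans ?_ (Finset.single_le_sum (f := fun x : Submodule ℂ (HomCoord n) =>
      |Real.log ‖xᗮ.starProjection (F (circleMap 0 r θ))‖| + |Real.log ‖F (circleMap 0 r θ)‖|)
      (fun _ _ => by positivity) (hfin.mem_toFinset.mpr ⟨hx, hxk⟩))
    rw [one_div, Real.log_inv, norm_neg, Real.norm_eq_abs]
    by_cases h0 : ‖xᗮ.starProjection (F (circleMap 0 r θ))‖ = 0
    · rw [h0, zero_div, Real.log_zero, abs_zero]
      positivity
    · rw [Real.log_div h0 (norm_ne_zero_iff.mpr (hF.no_common_zero _))]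
      exact abs_sub _ _

end HoloCurve

namespace HoloCurve

/-! ### Greedy choice of a basis among the hyperplanes -/

/-- Matroid greedy algorithm: `b i` minimizes `ℓ` among the elements of `A` with `ν` outside the
span of the earlier choices. That span has dimension `i`, so a subset of rank greater than `i`
contains a competitor of `b i`. -/
theorem exists_greedy_linearIndependent {ι V : Type*} [AddCommGroup V] [Module ℂ V]
    [FiniteDimensional ℂ V] (A : Finset ι) (ν : ι → V) (ℓ : ι → ℝ)
    (hspan : Submodule.span ℂ (ν '' A) = ⊤) (m : ℕ) (hm : m ≤ Module.finrank ℂ V) :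
    ∃ b : Fin m → ι, (∀ i, b i ∈ A) ∧ LinearIndependent ℂ (ν ∘ b) ∧
      ∀ i : Fin m, ∀ B ⊆ A, (i : ℕ) < Module.finrank ℂ (Submodule.span ℂ (ν '' B)) →
        ∃ c ∈ B, ℓ (b i) ≤ ℓ c := by
  classical
  induction m with
  | zero => exact ⟨Fin.elim0, fun i => i.elim0, linearIndependent_empty_type, fun i => i.elim0⟩
  | succ m ih =>
    obtain ⟨b, hbA, hb, hmin⟩ := ih (by omega)
    set K := Submodule.span ℂ (Set.range (ν ∘ b)) with hK
    have hKdim : Module.finrank ℂ K = m := by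
      rw [hK, finrank_span_eq_card hb, Fintype.card_fin]
    have key : ∀ B : Finset ι, m < Module.finrank ℂ (Submodule.span ℂ (ν '' B)) →
        ∃ c ∈ B, ν c ∉ K := by
      intro B hB
      by_contra! h
      have : Submodule.span ℂ (ν '' B) ≤ K := by
        rw [Submodule.span_le]
        rintro _ ⟨c, hc, rfl⟩
        exact h c hc
      have := Submodule.finrank_mono this
      omega
    have hne : (A.filter fun a => ν a ∉ K).Nonempty := by
      obtain ⟨c, hc, hcK⟩ := key A (by rw [hspan, finrank_top]; omega)
      exact ⟨c, Finset.mem_filter.mpr ⟨hc, hcK⟩⟩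
    obtain ⟨a, ha, hamin⟩ := Finset.exists_min_image _ ℓ hne
    rw [Finset.mem_filter] at ha
    refine ⟨Fin.snoc b a, ?_, ?_, ?_⟩
    · intro i
      refine Fin.lastCases ?_ (fun j => ?_) i
      · simpa using ha.1
      · simpa using hbA j
    · have : ν ∘ (Fin.snoc b a : Fin (m + 1) → ι) = Fin.snoc (ν ∘ b) (ν a) := by
        funext i
        refine Fin.lastCases ?_ (fun j => ?_) i <;> simp
      rw [this, linearIndependent_finSnoc]
      exact ⟨hb, ha.2⟩
    · intro i
      refine Fin.lastCases ?_ (fun j => ?_) i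
      · intro B hBA hB
        obtain ⟨c, hc, hcK⟩ := key B (by simpa using hB)
        exact ⟨c, hc, by simpa using hamin c (Finset.mem_filter.mpr ⟨hBA hc, hcK⟩)⟩
      · intro B hBA hB
        simpa using hmin j B hBA (by simpa using hB)

theorem exists_unit_normal {n : ℕ} {a : Submodule ℂ (HomCoord n)} (ha : IsCoatom a) :
    ∃ v : HomCoord n, ‖v‖ = 1 ∧ a = (Submodule.span ℂ {v})ᗮ := by
  have hne : aᗮ ≠ ⊥ := by
    rw [Ne, Submodule.orthogonal_eq_bot_iff]
    exact ha.1
  obtain ⟨v, hv, hv0⟩ := Submodule.exists_mem_ne_zero_of_ne_bot hne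
  have hv' : ‖v‖ ≠ 0 := norm_ne_zero_iff.mpr hv0
  refine ⟨(‖v‖⁻¹ : ℂ) • v, ?_, ?_⟩
  · rw [norm_smul]
    simp [hv']
  · have hle : a ≤ (Submodule.span ℂ {(‖v‖⁻¹ : ℂ) • v})ᗮ := by
      rw [Submodule.le_orthogonal_iff_le_orthogonal, Submodule.span_le]
      simpa using Submodule.smul_mem _ _ hv
    refine (ha.le_iff.mp hle).resolve_left ?_ |>.symm
    rw [Submodule.orthogonal_eq_top_iff, Submodule.span_singleton_eq_bot]
    simp [hv0]

theorem sInf_eq_orthogonal_span {n : ℕ} {ν : Submodule ℂ (HomCoord n) → HomCoord n}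
    {B : Finset (Submodule ℂ (HomCoord n))} (hν : ∀ a ∈ B, a = (Submodule.span ℂ {ν a})ᗮ) :
    sInf (B : Set (Submodule ℂ (HomCoord n))) = (Submodule.span ℂ (ν '' B))ᗮ := by
  ext v
  rw [Submodule.mem_sInf, Submodule.mem_orthogonal]
  have h1 : ∀ a ∈ B, (v ∈ a ↔ inner ℂ (ν a) v = 0) := by
    intro a ha
    conv_lhs => rw [hν a ha]
    exact Submodule.mem_orthogonal_singleton_iff_inner_right
  constructor
  · intro h u hu
    induction hu using Submodule.span_induction with
    | mem x hx => obtain ⟨a, ha, rfl⟩ := hx; exact (h1 a ha).mp (h a ha)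
    | zero => simp
    | add x y _ _ hx hy => rw [inner_add_left, hx, hy, add_zero]
    | smul c x _ hx => rw [inner_smul_left, hx, mul_zero]
  · intro h a ha
    exact (h1 a ha).mpr (h _ (Submodule.subset_span ⟨a, ha, rfl⟩))

theorem codim_orthogonal {n : ℕ} (K : Submodule ℂ (HomCoord n)) :
    codim Kᗮ = Module.finrank ℂ K := by
  unfold codim
  have h1 := Submodule.finrank_quotient_add_finrank Kᗮ
  have h2 := K.finrank_add_finrank_orthogonal
  omega

theorem span_normals_eq_top {n : ℕ} {ν : Submodule ℂ (HomCoord n) → HomCoord n}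
    {A : Finset (Submodule ℂ (HomCoord n))} (hν : ∀ a ∈ A, a = (Submodule.span ℂ {ν a})ᗮ)
    (hA : IsComplete A) : Submodule.span ℂ (ν '' A) = ⊤ := by
  obtain ⟨B, hBA, hB⟩ := hA
  rw [sInf_eq_orthogonal_span fun a ha => hν a (hBA ha)] at hB
  have : Submodule.span ℂ (ν '' B) = ⊤ := Submodule.orthogonal_eq_bot_iff.mp hB.symm
  rw [eq_top_iff, ← this]
  exact Submodule.span_mono (Set.image_mono hBA)

/-- The sum of the logarithmic proximities to the flats of all codimensions is dominated by the
sum of the logarithmic proximities to the members of one basis chosen from `A`. -/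
theorem exists_basis_sum_log_flatDist_le {n : ℕ} {A : Finset (Submodule ℂ (HomCoord n))}
    {ν : Submodule ℂ (HomCoord n) → HomCoord n} (hν : ∀ a ∈ A, a = (Submodule.span ℂ {ν a})ᗮ)
    (hν1 : ∀ a ∈ A, ‖ν a‖ = 1) (hA : IsComplete A) (v : HomCoord n) (hv : v ≠ 0)
    (hgen : ∀ a ∈ A, inner ℂ (ν a) v ≠ 0) :
    ∃ b : Fin (n + 1) → A, LinearIndependent ℂ (fun i => ν (b i)) ∧
      ∑ k ∈ Finset.Icc 1 n, Real.log (1 / flatDist A k (Projectivization.mk ℂ v hv)) ≤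
        ∑ i, Real.log (‖v‖ / ‖inner ℂ (ν (b i)) v‖) := by
  obtain ⟨b, hbA, hb, hmin⟩ := exists_greedy_linearIndependent A ν (fun a => ‖inner ℂ (ν a) v‖)
    (span_normals_eq_top hν hA) (n + 1) (by simp)
  refine ⟨fun i => ⟨b i, hbA i⟩, hb, ?_⟩
  have hv0 : 0 < ‖v‖ := norm_pos_iff.mpr hv
  have hpos : ∀ a ∈ A, 0 < ‖inner ℂ (ν a) v‖ := fun a ha => norm_pos_iff.mpr (hgen a ha)
  have hnonneg : ∀ i, 0 ≤ Real.log (‖v‖ / ‖inner ℂ (ν (b i)) v‖) := by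
    intro i
    apply Real.log_nonneg
    rw [one_le_div (hpos _ (hbA i))]
    simpa [hν1 _ (hbA i)] using norm_inner_le_norm (𝕜 := ℂ) (ν (b i)) v
  have hterm : ∀ i : Fin n, Real.log (1 / flatDist A (i + 1) (Projectivization.mk ℂ v hv)) ≤
      Real.log (‖v‖ / ‖inner ℂ (ν (b i.castSucc)) v‖) := by
    intro i
    rcases Set.eq_empty_or_nonempty {x | x ∈ flats A ∧ codim x = i + 1} with he | hne
    · simpa [flatDist, he] using hnonneg i.castSucc
    obtain ⟨x, ⟨B, hBA, rfl⟩, hxk, hd⟩ := flatDist_mem (Projectivization.mk ℂ v hv) hne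
    have hsInf := sInf_eq_orthogonal_span fun a ha => hν a (hBA ha)
    have hBdim : Module.finrank ℂ (Submodule.span ℂ (ν '' B)) = i + 1 := by
      rw [← codim_orthogonal, ← hsInf, hxk]
    obtain ⟨c, hc, hle⟩ := hmin i.castSucc B hBA (by rw [hBdim]; simp)
    rw [hd, distTo_mk _ _ _ (ne_bot_of_codim_le (hxk.le.trans (by omega))), one_div, inv_div]
    set x := sInf (B : Set (Submodule ℂ (HomCoord n)))
    have hcx : ν c ∈ xᗮ := by
      rw [hsInf, Submodule.orthogonal_orthogonal]
      exact Submodule.subset_span ⟨c, hc, rfl⟩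
    -- `ν c` is a unit vector of `xᗮ`, so its product with `v` sees only the component of `v` in
    -- `xᗮ`, whose norm is `‖v‖` times the distance to `x`.
    have hge : ‖inner ℂ (ν c) v‖ ≤ ‖xᗮ.starProjection v‖ := by
      have h := norm_inner_le_norm (𝕜 := ℂ) (ν c) (xᗮ.starProjection v)
      rwa [← Submodule.inner_starProjection_left_eq_right,
        Submodule.starProjection_eq_self_iff.mpr hcx, hν1 c (hBA hc), one_mul] at h
    have := hpos _ (hbA i.castSucc)
    have hP : 0 < ‖xᗮ.starProjection v‖ := (hpos c (hBA hc)).trans_le hge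
    apply Real.log_le_log (by positivity)
    exact div_le_div_of_nonneg_left hv0.le this (hle.trans hge)
  have hsum : ∑ k ∈ Finset.Icc 1 n, Real.log (1 / flatDist A k (Projectivization.mk ℂ v hv)) =
      ∑ i : Fin n, Real.log (1 / flatDist A (i + 1) (Projectivization.mk ℂ v hv)) := by
    rw [← Finset.sum_range (fun i => Real.log (1 / flatDist A (i + 1) (Projectivization.mk ℂ v hv))),
      ← Finset.Ico_add_one_right_eq_Icc, Finset.sum_Ico_eq_sum_range]
    simp [add_comm]
  rw [hsum, Fin.sum_univ_castSucc]
  -- There are `n` codimensions but `n + 1` basis members; the last term is nonnegative and is added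
  -- for free.
  exact (Finset.sum_le_sum fun i _ => hterm i).trans (le_add_of_nonneg_right (hnonneg _))

end HoloCurve

noncomputable section

namespace HoloCurve

/-! ### Wronskians -/

/-- The Wronskian matrix of a finite family of functions. -/
def wronskianMatrix {m : ℕ} (f : Fin m → ℂ → ℂ) (z : ℂ) : Matrix (Fin m) (Fin m) ℂ :=
  Matrix.of fun i j => iteratedDeriv (i : ℕ) (f j) z

theorem wronskianMatrix_congr {m : ℕ} {f g : Fin m → ℂ → ℂ} {z : ℂ}
    (h : ∀ j, f j =ᶠ[nhds z] g j) : wronskianMatrix f z = wronskianMatrix g z := by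
  ext i j
  exact (h j).iteratedDeriv_eq _

/-- By Leibniz's rule the matrix of the products is that of `h` multiplied on the left by a lower
triangular matrix with diagonal entries `φ z`. -/
theorem det_wronskianMatrix_mul {m : ℕ} (h : Fin m → ℂ → ℂ) (φ : ℂ → ℂ) (z : ℂ)
    (hh : ∀ j, AnalyticAt ℂ (h j) z) (hφ : AnalyticAt ℂ φ z) :
    (wronskianMatrix (fun j w => h j w * φ w) z).det = φ z ^ m * (wronskianMatrix h z).det := by
  set L : Matrix (Fin m) (Fin m) ℂ := Matrix.of fun i k =>
    if k ≤ i then ((i : ℕ).choose k : ℂ) * iteratedDeriv ((i : ℕ) - k) φ z else 0 with hL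
  have hmul : wronskianMatrix (fun j w => h j w * φ w) z = L * wronskianMatrix h z := by
    ext i j
    rw [Matrix.mul_apply]
    simp only [wronskianMatrix, Matrix.of_apply, hL]
    rw [iteratedDeriv_fun_mul (hh j).contDiffAt hφ.contDiffAt, Finset.sum_range,
      ← Finset.sum_subset (Finset.subset_univ (Finset.Iic i))]
    -- For `k ≤ i` the remainder modulo `i + 1` is `k` itself; it only makes the reindexing map
    -- total.
    · refine (Finset.sum_nbij (fun k : Fin m => (⟨k % ((i : ℕ) + 1), Nat.mod_lt _ (by omega)⟩ :
        Fin ((i : ℕ) + 1))) ?_ ?_ ?_ ?_).symm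
      · simp
      · intro a ha b hb hab
        simp only [Finset.coe_Iic, Set.mem_Iic, Fin.le_def] at ha hb
        simp only [Fin.mk.injEq] at hab
        rw [Nat.mod_eq_of_lt (by omega), Nat.mod_eq_of_lt (by omega)] at hab
        exact Fin.ext hab
      · intro a _
        refine ⟨⟨a, by omega⟩, ?_, ?_⟩
        · simp only [Finset.coe_Iic, Set.mem_Iic, Fin.le_def]
          omega
        · exact Fin.ext (Nat.mod_eq_of_lt a.2)
      · intro a ha
        simp only [Finset.mem_Iic] at ha
        have : (a : ℕ) % ((i : ℕ) + 1) = a := Nat.mod_eq_of_lt (by omega)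
        simp only [this, if_pos ha]
        ring
    · intro k _ hk
      rw [Finset.mem_Iic] at hk
      rw [if_neg hk, zero_mul]
  have hdet : L.det = φ z ^ m := by
    rw [Matrix.det_of_isLowerTriangular]
    · simp [hL]
    · intro i j hij
      have : ¬ j ≤ i := by simpa using hij
      simp [hL, this]
  rw [hmul, Matrix.det_mul, hdet]

theorem det_wronskianMatrix_of_head_eq_one {m : ℕ} (h : Fin (m + 1) → ℂ → ℂ) (z : ℂ)
    (h0 : h 0 =ᶠ[nhds z] fun _ => 1) :
    (wronskianMatrix h z).det = (wronskianMatrix (fun j => deriv (h j.succ)) z).det := by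
  have hcol : ∀ i : Fin (m + 1), wronskianMatrix h z i 0 = if i = 0 then 1 else 0 := by
    intro i
    simp only [wronskianMatrix, Matrix.of_apply]
    rw [h0.iteratedDeriv_eq, iteratedDeriv_const]
    simp
  rw [Matrix.det_succ_column_zero, Finset.sum_eq_single 0]
  · rw [hcol]
    simp only [Fin.val_zero, pow_zero, if_true, one_mul, Fin.succAbove_zero]
    congr 1
    ext i j
    simp only [wronskianMatrix, Matrix.of_apply, Matrix.submatrix_apply, Fin.val_succ]
    rw [iteratedDeriv_succ']
  · intro i _ hi
    rw [hcol, if_neg hi]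
    ring
  · simp

/-- Induction on `m`. Where `f 0 ≠ 0`, divide by it: the Wronskian reduces to that of the
derivatives of `f j / f 0`, a shorter family. A linear relation among these integrates to one among
the quotients, the constant of integration becoming the coefficient of `f 0`. The open set shrinks
at each stage. -/
theorem exists_linear_relation_of_wronskian_eq_zero (m : ℕ) (f : Fin m → ℂ → ℂ) (U : Set ℂ)
    (hU : IsOpen U) (hne : U.Nonempty) (hf : ∀ j, DifferentiableOn ℂ (f j) U)
    (hW : ∀ z ∈ U, (wronskianMatrix f z).det = 0) :
    ∃ V ⊆ U, IsOpen V ∧ V.Nonempty ∧ ∃ c : Fin m → ℂ, c ≠ 0 ∧ ∀ z ∈ V, ∑ j, c j * f j z = 0 := by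
  induction m generalizing U with
  | zero =>
    obtain ⟨z, hz⟩ := hne
    -- The empty determinant is `1`, so the hypothesis is contradictory.
    simpa using hW z hz
  | succ m ih =>
    by_cases h0 : ∀ z ∈ U, f 0 z = 0
    · refine ⟨U, subset_rfl, hU, hne, Pi.single 0 1, by simp, fun z hz => ?_⟩
      rw [Finset.sum_eq_single 0]
      · simp [h0 z hz]
      · intro j _ hj
        simp [hj]
      · simp
    push Not at h0
    obtain ⟨z₀, hz₀, hfz₀⟩ := h0
    set V := U ∩ (f 0) ⁻¹' {0}ᶜ with hV
    have hVo : IsOpen V := (hf 0).continuousOn.isOpen_inter_preimage hU isOpen_compl_singleton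
    have hVU : V ⊆ U := Set.inter_subset_left
    have hV0 : ∀ z ∈ V, f 0 z ≠ 0 := fun z hz => hz.2
    set h : Fin (m + 1) → ℂ → ℂ := fun j z => f j z / f 0 z with hh
    have hhd : ∀ j, DifferentiableOn ℂ (h j) V := fun j =>
      ((hf j).mono hVU).div ((hf 0).mono hVU) hV0
    have hfa : ∀ j, ∀ z ∈ V, AnalyticAt ℂ (f j) z := fun j z hz =>
      (hf j).analyticAt (hU.mem_nhds (hVU hz))
    have hha : ∀ j, ∀ z ∈ V, AnalyticAt ℂ (h j) z := fun j z hz =>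
      (hhd j).analyticAt (hVo.mem_nhds hz)
    have hWh : ∀ z ∈ V, (wronskianMatrix (fun j : Fin m => deriv (h j.succ)) z).det = 0 := by
      intro z hz
      have hnear : ∀ᶠ w in nhds z, f 0 w ≠ 0 := by
        filter_upwards [hVo.mem_nhds hz] with w hw using hV0 w hw
      rw [← det_wronskianMatrix_of_head_eq_one h z]
      · have h1 := det_wronskianMatrix_mul h (f 0) z (fun j => hha j z hz) (hfa 0 z hz)
        have h2 : wronskianMatrix (fun j w => h j w * f 0 w) z = wronskianMatrix f z := by
          apply wronskianMatrix_congr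
          intro j
          filter_upwards [hnear] with w hw
          simp only [hh]
          field_simp
        rw [h2, hW z (hVU hz)] at h1
        exact (mul_eq_zero.mp h1.symm).resolve_left (pow_ne_zero _ (hV0 z hz))
      · filter_upwards [hnear] with w hw
        simp [hh, hw]
    obtain ⟨V', hV'V, hV'o, ⟨z₁, hz₁⟩, c, hc, hrel⟩ := ih (fun j => deriv (h j.succ)) V hVo
      ⟨z₀, hz₀, hfz₀⟩ (fun j => (hhd j.succ).deriv hVo) hWh
    obtain ⟨ε, hε, hball⟩ := Metric.isOpen_iff.mp hV'o z₁ hz₁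
    have hBV : Metric.ball z₁ ε ⊆ V := hball.trans hV'V
    set G : ℂ → ℂ := fun z => ∑ j : Fin m, c j * h j.succ z with hG
    have hGd : DifferentiableOn ℂ G (Metric.ball z₁ ε) := by
      apply DifferentiableOn.fun_sum
      intro j _
      exact ((hhd j.succ).mono hBV).const_mul (c j)
    have hG' : Set.EqOn (deriv G) 0 (Metric.ball z₁ ε) := by
      intro z hz
      have : HasDerivAt G (∑ j : Fin m, c j * deriv (h j.succ) z) z := by
        apply HasDerivAt.fun_sum
        intro j _
        exact (hha j.succ z (hBV hz)).differentiableAt.hasDerivAt.const_mul (c j)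
      rw [this.deriv]
      exact hrel z (hball hz)
    refine ⟨Metric.ball z₁ ε, hBV.trans hVU, Metric.isOpen_ball, ⟨z₁, Metric.mem_ball_self hε⟩,
      Fin.cons (-G z₁) c, ?_, fun z hz => ?_⟩
    · intro h0
      apply hc
      funext j
      simpa using congrFun h0 j.succ
    · have hconst : G z = G z₁ := Metric.isOpen_ball.is_const_of_deriv_eq_zero
        (convex_ball z₁ ε).isPreconnected hGd hG' hz (Metric.mem_ball_self hε)
      rw [Fin.sum_univ_succ]
      simp only [Fin.cons_zero, Fin.cons_succ]
      rw [← hconst, hG]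
      simp only [hh]
      rw [← Finset.sum_neg_distrib, Finset.sum_mul, ← Finset.sum_add_distrib]
      apply Finset.sum_eq_zero
      intro j _
      have := hV0 z (hBV hz)
      field_simp
      ring

variable {n : ℕ} {f : ℂ → ProjSpace n} {F : ℂ → HomCoord n}

theorem wronskian_eq_det (F : ℂ → HomCoord n) (z : ℂ) :
    wronskian F z = (wronskianMatrix (fun j w => F w j) z).det := rfl

theorem LinearlyNondegenerate.eq_zero_of_forall (hnd : LinearlyNondegenerate F)
    {c : Fin (n + 1) → ℂ} (h : ∀ z, ∑ j, c j * F z j = 0) : c = 0 := by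
  have := Fintype.linearIndependent_iff.mp hnd c (by
    funext z
    simpa using h z)
  exact funext this

/-- A vanishing Wronskian yields a relation on some open set, which the identity theorem extends to
the plane. -/
theorem exists_wronskian_ne_zero (hF : ∀ j, Differentiable ℂ fun z => F z j)
    (hnd : LinearlyNondegenerate F) : ∃ z, wronskian F z ≠ 0 := by
  by_contra! hW
  obtain ⟨V, -, hVo, ⟨z₁, hz₁⟩, c, hc, hrel⟩ := exists_linear_relation_of_wronskian_eq_zero (n + 1)
    (fun j z => F z j) Set.univ isOpen_univ Set.univ_nonempty
    (fun j => (hF j).differentiableOn) (fun z _ => hW z)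
  apply hc
  apply hnd.eq_zero_of_forall
  have hd : Differentiable ℂ fun z => ∑ j, c j * F z j :=
    Differentiable.fun_sum fun j _ => (hF j).const_mul (c j)
  have := AnalyticOnNhd.eq_of_eventuallyEq (f := fun z => ∑ j, c j * F z j) (g := fun _ => 0)
    (fun z _ => hd.analyticAt z) (fun z _ => analyticAt_const) (z₀ := z₁)
    (by filter_upwards [hVo.mem_nhds hz₁] with z hz using hrel z hz)
  exact fun z => congrFun this z

theorem differentiable_wronskian (hF : ∀ j, Differentiable ℂ fun z => F z j) :
    Differentiable ℂ (wronskian F) := by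
  have : wronskian F = fun z => ∑ σ : Equiv.Perm (Fin (n + 1)),
      ((Equiv.Perm.sign σ : ℤ) : ℂ) * ∏ i, iteratedDeriv ((σ i : Fin (n + 1)) : ℕ) (fun w => F w i) z := by
    funext z
    rw [wronskian, Matrix.det_apply']
    simp
  rw [this]
  apply Differentiable.fun_sum
  intro σ _
  apply Differentiable.const_mul
  apply Differentiable.fun_finsetProd
  intro i _
  exact (hF i).contDiff.differentiable_iteratedDeriv _ (WithTop.coe_lt_top _)

/-- The matrix of coefficients of the linear forms dual to the vectors `v i`. -/
def dualMatrix (v : Fin (n + 1) → HomCoord n) : Matrix (Fin (n + 1)) (Fin (n + 1)) ℂ :=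
  Matrix.of fun k i => starRingEnd ℂ (v i k)

theorem inner_eq_sum_dualMatrix (v : Fin (n + 1) → HomCoord n) (w : HomCoord n) (i : Fin (n + 1)) :
    inner ℂ (v i) w = ∑ k, w k * dualMatrix v k i := by
  simp [dualMatrix, PiLp.inner_apply]

theorem det_dualMatrix_ne_zero {v : Fin (n + 1) → HomCoord n} (hv : LinearIndependent ℂ v) :
    (dualMatrix v).det ≠ 0 := by
  intro h0
  obtain ⟨w, hw, hw0⟩ := Matrix.exists_vecMul_eq_zero_iff.mpr h0
  set w' : HomCoord n := WithLp.toLp 2 w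
  have hspan : Submodule.span ℂ (Set.range v) = ⊤ :=
    hv.span_eq_top_of_card_eq_finrank' (by simp)
  have hort : ∀ u : HomCoord n, inner ℂ u w' = 0 := by
    intro u
    have hu : u ∈ Submodule.span ℂ (Set.range v) := by rw [hspan]; trivial
    induction hu using Submodule.span_induction with
    | mem x hx =>
      obtain ⟨i, rfl⟩ := hx
      rw [inner_eq_sum_dualMatrix]
      exact congrFun hw0 i
    | zero => simp
    | add x y _ _ hx hy => rw [inner_add_left, hx, hy, add_zero]
    | smul c x _ hx => rw [inner_smul_left, hx, mul_zero]
  have : w' = 0 := inner_self_eq_zero.mp (hort w')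
  apply hw
  funext i
  exact congrFun (congrArg WithLp.ofLp this) i

/-- The linear forms are constant combinations of the coordinates, so differentiation commutes with
right multiplication by `dualMatrix v`. -/
theorem det_wronskianMatrix_inner (hF : ∀ j, Differentiable ℂ fun z => F z j)
    (v : Fin (n + 1) → HomCoord n) (z : ℂ) :
    (wronskianMatrix (fun i w => inner ℂ (v i) (F w)) z).det =
      wronskian F z * (dualMatrix v).det := by
  rw [wronskian_eq_det, ← Matrix.det_mul]
  congr 1
  ext i j
  rw [Matrix.mul_apply]
  simp only [wronskianMatrix, Matrix.of_apply, inner_eq_sum_dualMatrix]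
  rw [iteratedDeriv_fun_sum]
  · apply Finset.sum_congr rfl
    intro k _
    simp_rw [mul_comm _ (dualMatrix v k j)]
    rw [iteratedDeriv_const_mul_field]
  · intro k _
    exact ((hF k).mul_const _).contDiff.contDiffAt

/-- The total size of the logarithmic derivatives up to order `n` of the functions `g a / φ`. -/
def logDerivSum {ι : Type*} (A : Finset ι) (n : ℕ) (h : ι → ℂ → ℂ) (z : ℂ) : ℝ :=
  ∑ a ∈ A, ∑ i ∈ Finset.range (n + 1), Real.posLog ‖iteratedDeriv i (h a) z / h a z‖

theorem norm_le_exp_logDerivSum {ι : Type*} {A : Finset ι} {n : ℕ} (h : ι → ℂ → ℂ) (z : ℂ)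
    {a : ι} (ha : a ∈ A) {i : ℕ} (hi : i ≤ n) :
    ‖iteratedDeriv i (h a) z / h a z‖ ≤ Real.exp (logDerivSum A n h z) := by
  have h1 : Real.posLog ‖iteratedDeriv i (h a) z / h a z‖ ≤ logDerivSum A n h z := by
    unfold logDerivSum
    refine le_trans ?_ (Finset.single_le_sum (f := fun a => ∑ i ∈ Finset.range (n + 1),
      Real.posLog ‖iteratedDeriv i (h a) z / h a z‖)
      (fun a _ => Finset.sum_nonneg fun i _ => Real.posLog_nonneg) ha)
    exact Finset.single_le_sum (f := fun i => Real.posLog ‖iteratedDeriv i (h a) z / h a z‖)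
      (fun i _ => Real.posLog_nonneg) (Finset.mem_range.mpr (by omega))
  rcases (norm_nonneg (iteratedDeriv i (h a) z / h a z)).eq_or_lt with h0 | h0
  · rw [← h0]
    positivity
  · rw [← Real.log_le_iff_le_exp h0]
    exact (le_max_right _ _).trans h1

/-- Write each form as `h φ`, extract `φ ^ (n + 1)` from the Wronskian and `h (b j)` from each
column. The extracted factors multiply to the product of the forms, and the remaining determinant
has logarithmic derivatives as entries. -/
theorem log_wronskian_le (hF : ∀ j, Differentiable ℂ fun z => F z j)
    {A : Finset (Submodule ℂ (HomCoord n))} {ν : Submodule ℂ (HomCoord n) → HomCoord n}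
    (φ : ℂ → ℂ) (hφ : Differentiable ℂ φ)
    (b : Fin (n + 1) → A) (hb : LinearIndependent ℂ fun i => ν (b i)) (z : ℂ)
    (hφz : φ z ≠ 0) (hWz : wronskian F z ≠ 0) (hgen : ∀ a ∈ A, inner ℂ (ν a) (F z) ≠ 0) :
    Real.log ‖wronskian F z‖ + Real.log ‖(dualMatrix fun i => ν (b i)).det‖ ≤
      ∑ i, Real.log ‖inner ℂ (ν (b i)) (F z)‖ + Real.log (n + 1).factorial +
        (n + 1) * logDerivSum A n (fun a w => inner ℂ (ν a) (F w) / φ w) z := by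
  set h : Submodule ℂ (HomCoord n) → ℂ → ℂ := fun a w => inner ℂ (ν a) (F w) / φ w with hh
  have hgd : ∀ v : HomCoord n, Differentiable ℂ fun w => inner ℂ v (F w) := by
    intro v
    have : Differentiable ℂ F := by rw [differentiable_euclidean]; exact hF
    exact (innerSL ℂ v).differentiable.comp this
  have hnear : ∀ᶠ w in nhds z, φ w ≠ 0 := hφ.continuous.continuousAt.eventually_ne hφz
  have hha : ∀ a, AnalyticAt ℂ (h a) z := fun a =>
    ((hgd (ν a)).analyticAt z).div (hφ.analyticAt z) hφz
  have hhz : ∀ i, h (b i) z ≠ 0 := fun i => div_ne_zero (hgen _ (b i).2) hφz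
  set q : Matrix (Fin (n + 1)) (Fin (n + 1)) ℂ :=
    Matrix.of fun i j => iteratedDeriv (i : ℕ) (h (b j)) z / h (b j) z with hq
  have h1 : (wronskianMatrix (fun i w => inner ℂ (ν (b i)) (F w)) z).det =
      (∏ i, inner ℂ (ν (b i)) (F z)) * q.det := by
    have e1 : wronskianMatrix (fun i w => inner ℂ (ν (b i)) (F w)) z =
        wronskianMatrix (fun i w => h (b i) w * φ w) z := by
      apply wronskianMatrix_congr
      intro j
      filter_upwards [hnear] with w hw
      simp only [hh]
      field_simp
    have e2 : wronskianMatrix (fun i => h (b i)) z = Matrix.of fun i j => h (b j) z * q i j := by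
      ext i j
      simp only [wronskianMatrix, hq, Matrix.of_apply]
      field_simp [hhz j]
    rw [e1, det_wronskianMatrix_mul (fun i => h (b i)) φ z (fun j => hha _) (hφ.analyticAt z), e2,
      Matrix.det_mul_row, ← mul_assoc]
    congr 1
    have : φ z ^ (n + 1) = ∏ _i : Fin (n + 1), φ z := by simp
    rw [this, ← Finset.prod_mul_distrib]
    apply Finset.prod_congr rfl
    intro i _
    simp only [hh]
    field_simp
  have hdet := det_wronskianMatrix_inner hF (fun i => ν (b i)) z
  rw [h1] at hdet
  have hc := det_dualMatrix_ne_zero hb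
  have hq0 : q.det ≠ 0 := by
    intro h0
    rw [h0, mul_zero] at hdet
    exact mul_ne_zero hWz hc hdet.symm
  -- Expansion over permutations: `(n + 1)!` products of `n + 1` entries.
  have hqle : ‖q.det‖ ≤ (n + 1).factorial * Real.exp (logDerivSum A n h z) ^ (n + 1) := by
    have := Matrix.det_le (A := q) (abv := NormedField.toAbsoluteValue ℂ)
      (x := Real.exp (logDerivSum A n h z)) (fun i j => norm_le_exp_logDerivSum h z (b j).2
        (Nat.lt_succ_iff.mp i.2))
    rw [nsmul_eq_mul, Fintype.card_fin] at this
    exact this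
  have hlogq : Real.log ‖q.det‖ ≤ Real.log (n + 1).factorial + (n + 1) * logDerivSum A n h z := by
    refine (Real.log_le_log (norm_pos_iff.mpr hq0) hqle).trans_eq ?_
    rw [Real.log_mul (by positivity) (by positivity), Real.log_pow, Real.log_exp]
    push_cast
    ring
  have hlog : Real.log ‖wronskian F z‖ + Real.log ‖(dualMatrix fun i => ν (b i)).det‖ =
      ∑ i, Real.log ‖inner ℂ (ν (b i)) (F z)‖ + Real.log ‖q.det‖ := by
    rw [← Real.log_mul (norm_ne_zero_iff.mpr hWz) (norm_ne_zero_iff.mpr hc), ← norm_mul, ← hdet,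
      norm_mul, norm_prod, Real.log_mul, Real.log_prod]
    · exact fun i _ => norm_ne_zero_iff.mpr (hgen _ (b i).2)
    · exact Finset.prod_ne_zero_iff.mpr fun i _ => norm_ne_zero_iff.mpr (hgen _ (b i).2)
    · exact norm_ne_zero_iff.mpr hq0
  rw [hlog]
  linarith

end HoloCurve
end

noncomputable section

namespace HoloCurve

/-! ### Circle averages -/

/-- A codiscrete change of `f` on the circle does not affect its average, so `f` may be replaced by
`min f g`. -/
theorem circleAverage_mono_codiscreteWithin {f g : ℂ → ℝ} {c : ℂ} {r : ℝ} (hr : r ≠ 0)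
    (hf : CircleIntegrable f c r) (hg : CircleIntegrable g c r)
    (h : ∀ᶠ z in codiscreteWithin (Metric.sphere c |r|), f z ≤ g z) :
    Real.circleAverage f c r ≤ Real.circleAverage g c r := by
  classical
  set f' : ℂ → ℝ := fun z => if f z ≤ g z then f z else g z with hf'
  have heq : f =ᶠ[codiscreteWithin (Metric.sphere c |r|)] f' := by
    filter_upwards [h] with z hz
    simp [hf', hz]
  rw [Real.circleAverage_congr_codiscreteWithin heq hr]
  refine Real.circleAverage_mono (hf.congr_codiscreteWithin heq) hg fun z _ => ?_
  simp only [hf']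
  split_ifs with hz
  · exact hz
  · exact le_rfl

/-- Jordan's inequality `sin θ ≥ 2θ/π` gives domination by a multiple of `θ ^ (-1/2)` on the first
quarter period; reflection and periodicity do the rest. -/
theorem intervalIntegrable_inv_sqrt_abs_sin (a b : ℝ) :
    IntervalIntegrable (fun θ => (Real.sqrt |Real.sin θ|)⁻¹) volume a b := by
  have hmeas : Measurable fun θ => (Real.sqrt |Real.sin θ|)⁻¹ :=
    (Real.continuous_sqrt.comp Real.continuous_sin.abs).measurable.inv
  have h1 : IntervalIntegrable (fun θ => (Real.sqrt |Real.sin θ|)⁻¹) volume 0 (Real.pi / 2) := by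
    have hb : IntervalIntegrable (fun θ : ℝ => (Real.sqrt (2 / Real.pi))⁻¹ * θ ^ (-(1 / 2) : ℝ))
        volume 0 (Real.pi / 2) :=
      (intervalIntegral.intervalIntegrable_rpow' (by norm_num)).const_mul _
    refine hb.mono_fun' hmeas.aestronglyMeasurable ?_
    rw [EventuallyLE, ae_restrict_iff' measurableSet_uIoc]
    refine Eventually.of_forall fun θ hθ => ?_
    rw [Set.uIoc_of_le (by positivity)] at hθ
    have hsin := Real.mul_le_sin hθ.1.le hθ.2
    have hpos : 0 < 2 / Real.pi * θ := mul_pos (by positivity) hθ.1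
    rw [Real.norm_of_nonneg (by positivity), abs_of_pos (hpos.trans_le hsin),
      Real.rpow_neg hθ.1.le, ← Real.sqrt_eq_rpow, ← mul_inv, ← Real.sqrt_mul (by positivity)]
    have := Real.sqrt_pos.mpr hpos
    gcongr
  have h2 : IntervalIntegrable (fun θ => (Real.sqrt |Real.sin θ|)⁻¹) volume (Real.pi / 2)
      Real.pi := by
    have := (h1.comp_sub_left Real.pi).symm
    simp only [Real.sin_pi_sub, sub_zero] at this
    convert this using 1
    ring
  have hper : Function.Periodic (fun θ => (Real.sqrt |Real.sin θ|)⁻¹) Real.pi := by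
    intro θ
    simp [Real.sin_add_pi]
  refine hper.intervalIntegrable Real.pi_ne_zero (t := 0) ?_ a b
  simpa using h1.trans h2

/-- The average of `|sin θ|^{-1/2}` over a full period. -/
def sinAverage : ℝ := (2 * Real.pi)⁻¹ * ∫ θ in 0..2 * Real.pi, (Real.sqrt |Real.sin θ|)⁻¹

theorem sinAverage_nonneg : 0 ≤ sinAverage := by
  unfold sinAverage
  have : 0 ≤ ∫ θ in 0..2 * Real.pi, (Real.sqrt |Real.sin θ|)⁻¹ :=
    intervalIntegral.integral_nonneg (by positivity) fun θ _ => by positivity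
  positivity

/-- After rotating `a` to the nonnegative real axis, the left side is the absolute imaginary part of
the difference. The bound does not involve `‖a‖`. -/
theorem mul_abs_sin_le_norm_circleMap_sub (a : ℂ) {r : ℝ} (hr : 0 ≤ r) (θ : ℝ) :
    r * |Real.sin (θ - a.arg)| ≤ ‖circleMap 0 r θ - a‖ := by
  have h1 : ‖circleMap 0 r θ - a‖ =
      ‖(circleMap 0 r θ - a) * Complex.exp (-(a.arg * Complex.I))‖ := by
    rw [norm_mul, ← neg_mul, ← Complex.ofReal_neg, Complex.norm_exp_ofReal_mul_I, mul_one]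
  have h2 : (circleMap 0 r θ - a) * Complex.exp (-(a.arg * Complex.I)) =
      r * Complex.exp ((θ - a.arg : ℝ) * Complex.I) - ‖a‖ := by
    conv_lhs => rw [← Complex.norm_mul_exp_arg_mul_I a]
    rw [circleMap_zero, sub_mul, mul_assoc, mul_assoc, ← Complex.exp_add, ← Complex.exp_add]
    simp
    left
    ring_nf
  rw [h1, h2]
  refine le_trans (le_of_eq ?_) (Complex.abs_im_le_norm _)
  rw [Complex.sub_im, Complex.ofReal_im, sub_zero, Complex.im_ofReal_mul,
    Complex.exp_ofReal_mul_I_im, abs_mul, abs_of_nonneg hr]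

theorem ae_sin_sub_ne_zero (a : ℝ) : ∀ᵐ θ : ℝ, Real.sin (θ - a) ≠ 0 := by
  have : {θ : ℝ | ¬ Real.sin (θ - a) ≠ 0} ⊆ Set.range fun n : ℤ => (n : ℝ) * Real.pi + a := by
    intro θ hθ
    simp only [ne_eq, not_not, Set.mem_ofPred_eq, Real.sin_eq_zero_iff] at hθ
    obtain ⟨n, hn⟩ := hθ
    exact ⟨n, by simp [hn]⟩
  exact measure_mono_null this ((Set.countable_range _).measure_zero _)

theorem inv_sqrt_norm_circleMap_sub_le (a : ℂ) {r : ℝ} (hr : 0 < r) :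
    ∀ᵐ θ : ℝ, (Real.sqrt ‖circleMap 0 r θ - a‖)⁻¹ ≤
      (Real.sqrt r)⁻¹ * (Real.sqrt |Real.sin (θ - a.arg)|)⁻¹ := by
  filter_upwards [ae_sin_sub_ne_zero a.arg] with θ hθ
  rw [← mul_inv, ← Real.sqrt_mul hr.le]
  have : 0 < r * |Real.sin (θ - a.arg)| := mul_pos hr (abs_pos.mpr hθ)
  have := Real.sqrt_pos.mpr this
  have := mul_abs_sin_le_norm_circleMap_sub a hr.le θ
  gcongr

theorem circleIntegrable_inv_sqrt_norm_sub (a : ℂ) {r : ℝ} (hr : 0 < r) :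
    CircleIntegrable (fun z => (Real.sqrt ‖z - a‖)⁻¹) 0 r := by
  have hb : IntervalIntegrable (fun θ => (Real.sqrt r)⁻¹ * (Real.sqrt |Real.sin (θ - a.arg)|)⁻¹)
      volume 0 (2 * Real.pi) := by
    have h := (intervalIntegrable_inv_sqrt_abs_sin (0 - a.arg) (2 * Real.pi - a.arg)).comp_sub_right
      a.arg
    simp only [sub_add_cancel] at h
    exact h.const_mul _
  refine hb.mono_fun' ?_ ?_
  · apply Measurable.aestronglyMeasurable
    apply Measurable.inv
    apply Continuous.measurable
    fun_prop
  · filter_upwards [ae_restrict_of_ae (inv_sqrt_norm_circleMap_sub_le a hr)] with θ hθ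
    rwa [Real.norm_of_nonneg (by positivity)]

/-- The bound is uniform in `a`, even for `a` on the circle. This is why square roots are used: `1 /
‖z - a‖` itself is not integrable there. -/
theorem circleAverage_inv_sqrt_norm_sub_le (a : ℂ) {r : ℝ} (hr : 0 < r) :
    Real.circleAverage (fun z => (Real.sqrt ‖z - a‖)⁻¹) 0 r ≤ sinAverage * (Real.sqrt r)⁻¹ := by
  have hint : IntervalIntegrable (fun θ => (Real.sqrt |Real.sin (θ - a.arg)|)⁻¹)
      volume 0 (2 * Real.pi) := by
    have h := (intervalIntegrable_inv_sqrt_abs_sin (0 - a.arg) (2 * Real.pi - a.arg)).comp_sub_right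
      a.arg
    simpa only [sub_add_cancel] using h
  have hper : Function.Periodic (fun θ => (Real.sqrt |Real.sin θ|)⁻¹) (2 * Real.pi) := by
    intro θ
    simp
  have hshift : ∫ θ in 0..2 * Real.pi, (Real.sqrt |Real.sin (θ - a.arg)|)⁻¹ =
      ∫ θ in 0..2 * Real.pi, (Real.sqrt |Real.sin θ|)⁻¹ := by
    rw [intervalIntegral.integral_comp_sub_right (fun θ => (Real.sqrt |Real.sin θ|)⁻¹)]
    have := hper.intervalIntegral_add_eq (0 - a.arg) 0
    rw [zero_add] at this
    rw [← this]
    congr 1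
    ring
  have hle := intervalIntegral.integral_mono_ae (by positivity : (0 : ℝ) ≤ 2 * Real.pi)
    (circleIntegrable_inv_sqrt_norm_sub a hr) (hint.const_mul (Real.sqrt r)⁻¹)
    (inv_sqrt_norm_circleMap_sub_le a hr)
  rw [intervalIntegral.integral_const_mul, hshift] at hle
  unfold Real.circleAverage sinAverage
  rw [smul_eq_mul, mul_assoc]
  have : 0 ≤ (2 * Real.pi)⁻¹ := by positivity
  refine (mul_le_mul_of_nonneg_left hle this).trans_eq ?_
  ring

/-- If `V ≥ 0` has average at most `M - 1`, then `log (1 + V)` has average at most `log M`. -/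
theorem circleAverage_le_of_le_log_one_add {u V : ℂ → ℝ} {c : ℂ} {r M : ℝ} (hr : r ≠ 0)
    (hu : CircleIntegrable u c r) (hV : CircleIntegrable V c r) (hV0 : ∀ z, 0 ≤ V z) {K : ℝ}
    (hK : 0 ≤ K) {k : ℝ} (hM : 0 < M) (hVM : 1 + Real.circleAverage V c r ≤ M)
    (h : ∀ᶠ z in codiscreteWithin (Metric.sphere c |r|), u z ≤ k + K * Real.log (1 + V z)) :
    Real.circleAverage u c r ≤ k + K * Real.log M := by
  have hint : CircleIntegrable (fun z => (k + K * (Real.log M + M⁻¹ - 1)) + K * M⁻¹ * V z) c r :=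
    (circleIntegrable_const _ _ _).add (hV.const_mul _)
  have hle : Real.circleAverage u c r ≤ Real.circleAverage
      (fun z => (k + K * (Real.log M + M⁻¹ - 1)) + K * M⁻¹ * V z) c r := by
    apply circleAverage_mono_codiscreteWithin hr hu hint
    filter_upwards [h] with z hz
    refine hz.trans ?_
    -- Jensen's inequality by hand: the graph of the logarithm lies below its tangent at `M`.
    have h1 : Real.log (1 + V z) ≤ Real.log M + ((1 + V z) / M - 1) := by
      have h2 : 0 < 1 + V z := by linarith [hV0 z]
      have h3 := Real.log_le_sub_one_of_pos (div_pos h2 hM)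
      rw [Real.log_div h2.ne' hM.ne'] at h3
      linarith
    have h4 := mul_le_mul_of_nonneg_left h1 hK
    rw [add_div, div_eq_mul_inv, div_eq_mul_inv] at h4
    linarith
  refine hle.trans ?_
  have hVc : CircleIntegrable (fun z => K * M⁻¹ * V z) c r := hV.const_mul _
  rw [Real.circleAverage_fun_add (circleIntegrable_const _ _ _) hVc,
    Real.circleAverage_const]
  have : Real.circleAverage (fun z => K * M⁻¹ * V z) c r = K * M⁻¹ * Real.circleAverage V c r := by
    simpa using Real.circleAverage_fun_smul (a := K * M⁻¹) (f := V) (c := c) (R := r)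
  rw [this]
  have h5 : K * M⁻¹ * Real.circleAverage V c r ≤ K * M⁻¹ * (M - 1) := by
    apply mul_le_mul_of_nonneg_left _ (by positivity)
    linarith
  have h6 : K * M⁻¹ * (M - 1) = K * (1 - M⁻¹) := by
    field_simp
  linarith

end HoloCurve
end

noncomputable section

namespace HoloCurve

/-! ### Pointwise bounds for logarithmic derivatives -/

/-- `log ‖G‖` is harmonic, so the Poisson formula applies at both points. The two kernels differ by
the real part of `2ξ(ζ - z) / ((ξ - ζ)(ξ - z))`, whose denominator is at least `(R - r)² / 2` on the
circle. -/
theorem abs_log_norm_sub_log_norm_le {G : ℂ → ℂ} {r R : ℝ} (hrR : r < R)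
    (hG : AnalyticOnNhd ℂ G (Metric.closedBall 0 R)) (hG0 : ∀ z ∈ Metric.closedBall 0 R, G z ≠ 0)
    {z ζ : ℂ} (hz : ‖z‖ ≤ r) (hζ : ‖ζ - z‖ ≤ (R - r) / 2) :
    |Real.log ‖G ζ‖ - Real.log ‖G z‖| ≤
      4 * R * ‖ζ - z‖ / (R - r) ^ 2 * Real.circleAverage (fun ξ => |Real.log ‖G ξ‖|) 0 R := by
  have hr : 0 ≤ r := (norm_nonneg z).trans hz
  have hR : 0 < R := hr.trans_lt hrR
  have hRr : 0 < R - r := sub_pos.mpr hrR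
  have hζn : ‖ζ‖ ≤ r + (R - r) / 2 := by
    calc ‖ζ‖ = ‖z + (ζ - z)‖ := by ring_nf
      _ ≤ ‖z‖ + ‖ζ - z‖ := norm_add_le _ _
      _ ≤ _ := by linarith
  have hharm : InnerProductSpace.HarmonicOnNhd (fun x => Real.log ‖G x‖) (Metric.closedBall 0 R) :=
    fun x hx => (hG x hx).harmonicAt_log_norm (hG0 x hx)
  have hzb : z ∈ Metric.ball (0 : ℂ) R := by
    rw [mem_ball_zero_iff]; linarith
  have hζb : ζ ∈ Metric.ball (0 : ℂ) R := by
    rw [mem_ball_zero_iff]; linarith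
  have hdist : ∀ w : ℂ, ∀ ξ ∈ Metric.sphere (0 : ℂ) R, R - ‖w‖ ≤ ‖ξ - w‖ := by
    intro w ξ hξ
    have h := norm_sub_norm_le ξ w
    rwa [mem_sphere_zero_iff_norm.mp hξ] at h
  have hne : ∀ w ∈ Metric.ball (0 : ℂ) R, ∀ ξ ∈ Metric.sphere (0 : ℂ) R, ξ - w ≠ 0 := by
    intro w hw ξ hξ
    rw [mem_ball_zero_iff] at hw
    have := hdist w ξ hξ
    exact norm_pos_iff.mp (by linarith)
  have hlogcont : ContinuousOn (fun ξ => Real.log ‖G ξ‖) (Metric.sphere 0 |R|) := by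
    rw [abs_of_pos hR]
    apply ContinuousOn.log
    · exact (hG.continuousOn.mono Metric.sphere_subset_closedBall).norm
    · intro x hx
      exact norm_ne_zero_iff.mpr (hG0 x (Metric.sphere_subset_closedBall hx))
  have hker : ∀ w ∈ Metric.ball (0 : ℂ) R,
      ContinuousOn (Complex.re ∘ herglotzRieszKernel 0 w) (Metric.sphere 0 |R|) := by
    intro w hw
    rw [abs_of_pos hR, herglotzRieszKernel_fun_def]
    refine Complex.continuous_re.comp_continuousOn (ContinuousOn.div ?_ ?_ ?_)
    · fun_prop
    · fun_prop
    · intro ξ hξ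
      simpa using hne w hw ξ hξ
  have hP : ∀ w ∈ Metric.ball (0 : ℂ) R, CircleIntegrable
      (Complex.re ∘ herglotzRieszKernel 0 w • fun ξ => Real.log ‖G ξ‖) 0 R := fun w hw =>
    ((hker w hw).smul hlogcont).circleIntegrable'
  have habs : CircleIntegrable (fun ξ => |Real.log ‖G ξ‖|) 0 R := hlogcont.abs.circleIntegrable'
  rw [← hharm.circleAverage_re_herglotzRieszKernel_smul hζb,
    ← hharm.circleAverage_re_herglotzRieszKernel_smul hzb,
    ← Real.circleAverage_sub (hP ζ hζb) (hP z hzb)]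
  refine Real.abs_circleAverage_le_circleAverage_abs.trans ?_
  have hconst : ∀ K : ℝ, K * Real.circleAverage (fun ξ => |Real.log ‖G ξ‖|) 0 R =
      Real.circleAverage (fun ξ => K * |Real.log ‖G ξ‖|) 0 R := by
    intro K
    simpa using (Real.circleAverage_fun_smul (a := K) (f := fun ξ => |Real.log ‖G ξ‖|)
      (c := 0) (R := R)).symm
  rw [hconst]
  refine Real.circleAverage_mono ((hP ζ hζb).sub (hP z hzb)).abs (habs.const_mul _) ?_
  intro ξ hξ
  rw [abs_of_pos hR] at hξ
  simp only [Pi.abs_apply, Pi.sub_apply, smul_eq_mul, Pi.mul_apply, Function.comp_apply]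
  rw [← sub_mul, abs_mul]
  apply mul_le_mul_of_nonneg_right _ (abs_nonneg _)
  rw [← Complex.sub_re]
  refine (Complex.abs_re_le_norm _).trans ?_
  have e1 := hne z hzb ξ hξ
  have e2 := hne ζ hζb ξ hξ
  have : herglotzRieszKernel 0 ζ ξ - herglotzRieszKernel 0 z ξ =
      2 * ξ * (ζ - z) / ((ξ - ζ) * (ξ - z)) := by
    simp only [herglotzRieszKernel_fun_def, sub_zero]
    field_simp
    ring
  rw [this, norm_div, norm_mul, norm_mul, norm_mul, mem_sphere_zero_iff_norm.mp hξ]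
  have d1 : (R - r) / 2 ≤ ‖ξ - ζ‖ := by linarith [hdist ζ ξ hξ]
  have d2 : R - r ≤ ‖ξ - z‖ := by linarith [hdist z ξ hξ]
  have d3 : (R - r) ^ 2 / 2 ≤ ‖ξ - ζ‖ * ‖ξ - z‖ := by
    calc (R - r) ^ 2 / 2 = (R - r) / 2 * (R - r) := by ring
      _ ≤ _ := mul_le_mul d1 d2 hRr.le (norm_nonneg _)
  have d4 : 0 < (R - r) ^ 2 / 2 := by positivity
  calc ‖(2 : ℂ)‖ * R * ‖ζ - z‖ / (‖ξ - ζ‖ * ‖ξ - z‖) ≤ ‖(2 : ℂ)‖ * R * ‖ζ - z‖ / ((R - r) ^ 2 / 2) := by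
        gcongr
    _ = 4 * R * ‖ζ - z‖ / (R - r) ^ 2 := by
        rw [Complex.norm_ofNat]
        field_simp
        norm_num [mul_comm]

theorem abs_log_le_two_mul {u : ℝ} (h : |u - 1| ≤ 1 / 2) : |Real.log u| ≤ 2 * |u - 1| := by
  obtain ⟨h1, h2⟩ := abs_le.mp h
  have hu : 0 < u := by linarith
  rw [abs_le]
  constructor
  · have h3 := Real.one_sub_inv_le_log_of_pos hu
    have h4 : u⁻¹ - 1 ≤ 2 * |u - 1| := by
      have : u⁻¹ - 1 = (1 - u) / u := by field_simp
      rw [this, div_le_iff₀ hu]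
      have h5 : 1 - u ≤ |u - 1| := by rw [abs_sub_comm]; exact le_abs_self _
      nlinarith [abs_nonneg (u - 1)]
    linarith
  · have := Real.log_le_sub_one_of_pos hu
    linarith [le_abs_self (u - 1), abs_nonneg (u - 1)]

/-- On the circle of radius `t = 1 / (4X)` about `z` the function grows by a factor at most `e`: the
zeros and poles contribute at most `2tX = 1/2` to its logarithm, and so does `G`. Cauchy's estimate
follows. The summand `1 / (R - r)` of `X` keeps this circle in the disc, and `|D a| ≥ 1` keeps it
away from the points of `s`. -/
theorem norm_iteratedDeriv_div_le {G : ℂ → ℂ} {r R : ℝ} (hrR : r < R)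
    (hG : AnalyticOnNhd ℂ G (Metric.closedBall 0 R)) (hG0 : ∀ z ∈ Metric.closedBall 0 R, G z ≠ 0)
    (s : Finset ℂ) (D : ℂ → ℤ) (hD : ∀ a ∈ s, D a ≠ 0) {z : ℂ} (hz : ‖z‖ ≤ r) (hzs : z ∉ s) {X : ℝ}
    (hX : X = ∑ a ∈ s, |(D a : ℝ)| / ‖z - a‖ +
      (2 * R * Real.circleAverage (fun ξ => |Real.log ‖G ξ‖|) 0 R / (R - r) ^ 2 + 1 / (R - r)))
    (i : ℕ) :
    ‖iteratedDeriv i (fun w => (∏ a ∈ s, (w - a) ^ D a) * G w) z /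
        ((∏ a ∈ s, (z - a) ^ D a) * G z)‖ ≤ i.factorial * Real.exp 1 * (4 * X) ^ i := by
  set L := Real.circleAverage (fun ξ => |Real.log ‖G ξ‖|) 0 R with hL
  have hr : 0 ≤ r := (norm_nonneg z).trans hz
  have hR : 0 < R := hr.trans_lt hrR
  have hRr : 0 < R - r := sub_pos.mpr hrR
  have hL0 : 0 ≤ L := Real.circleAverage_nonneg_of_nonneg fun _ _ => abs_nonneg _
  have hza : ∀ a ∈ s, 0 < ‖z - a‖ := fun a ha =>
    norm_pos_iff.mpr (sub_ne_zero.mpr fun h => hzs (h ▸ ha))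
  have hsum0 : 0 ≤ ∑ a ∈ s, |(D a : ℝ)| / ‖z - a‖ := Finset.sum_nonneg fun a _ => by positivity
  have hY0 : 0 ≤ 2 * R * L / (R - r) ^ 2 := by positivity
  have hXR : 1 / (R - r) ≤ X := by linarith
  have hX0 : 0 < X := lt_of_lt_of_le (by positivity) hXR
  have hXL : 2 * R * L / (R - r) ^ 2 ≤ X := by
    have : 0 < 1 / (R - r) := by positivity
    linarith
  have hXs : ∑ a ∈ s, |(D a : ℝ)| / ‖z - a‖ ≤ X := by
    have : 0 < 1 / (R - r) := by positivity
    linarith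
  have hD1 : ∀ a ∈ s, 1 ≤ |(D a : ℝ)| := by
    intro a ha
    exact_mod_cast Int.one_le_abs (hD a ha)
  have hXa : ∀ a ∈ s, 1 / ‖z - a‖ ≤ X := by
    intro a ha
    refine le_trans ?_ ((Finset.single_le_sum (f := fun a => |(D a : ℝ)| / ‖z - a‖)
      (fun a _ => by positivity) ha).trans hXs)
    have := hza a ha
    have := hD1 a ha
    gcongr
  set t := 1 / (4 * X) with ht
  have ht0 : 0 < t := by positivity
  have htX : t * X = 1 / 4 := by rw [ht]; field_simp
  have hta : ∀ a ∈ s, t ≤ ‖z - a‖ / 4 := by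
    intro a ha
    have h1 := hza a ha
    have h2 := hXa a ha
    rw [div_le_iff₀ h1] at h2
    nlinarith
  have htR : t ≤ (R - r) / 4 := by
    have h2 := hXR
    rw [div_le_iff₀ hRr] at h2
    nlinarith
  have hin : ∀ w : ℂ, ‖w - z‖ ≤ t → w ∈ Metric.closedBall (0 : ℂ) R := by
    intro w hw
    rw [mem_closedBall_zero_iff]
    calc ‖w‖ = ‖z + (w - z)‖ := by ring_nf
      _ ≤ ‖z‖ + ‖w - z‖ := norm_add_le _ _
      _ ≤ R := by linarith
  have hwa : ∀ w : ℂ, ‖w - z‖ ≤ t → ∀ a ∈ s, w - a ≠ 0 := by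
    intro w hw a ha h0
    have h1 := hta a ha
    have h2 := hza a ha
    have : ‖z - a‖ ≤ t := by
      rw [← sub_eq_zero.mp h0, norm_sub_rev]
      exact hw
    linarith
  set H : ℂ → ℂ := fun w => (∏ a ∈ s, (w - a) ^ D a) * G w with hH
  have hH0 : ∀ w : ℂ, ‖w - z‖ ≤ t → H w ≠ 0 := fun w hw =>
    mul_ne_zero (Finset.prod_ne_zero_iff.mpr fun a ha => zpow_ne_zero _ (hwa w hw a ha))
      (hG0 w (hin w hw))
  have hHlog : ∀ w : ℂ, ‖w - z‖ ≤ t →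
      Real.log ‖H w‖ = ∑ a ∈ s, D a * Real.log ‖w - a‖ + Real.log ‖G w‖ := by
    intro w hw
    have h1 : ∀ a ∈ s, ‖w - a‖ ^ D a ≠ 0 := fun a ha =>
      zpow_ne_zero _ (norm_ne_zero_iff.mpr (hwa w hw a ha))
    simp only [hH]
    rw [norm_mul, norm_prod]
    simp_rw [norm_zpow]
    rw [Real.log_mul (Finset.prod_ne_zero_iff.mpr h1)
      (norm_ne_zero_iff.mpr (hG0 w (hin w hw))), Real.log_prod h1]
    simp_rw [Real.log_zpow]
  have hz0 : ‖z - z‖ ≤ t := by simp [ht0.le]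
  have hHz : 0 < ‖H z‖ := norm_pos_iff.mpr (hH0 z hz0)
  have hbound : ∀ w ∈ Metric.sphere z t, ‖H w‖ ≤ Real.exp 1 * ‖H z‖ := by
    intro w hw
    have hwt : ‖w - z‖ = t := by rwa [mem_sphere_iff_norm] at hw
    have hHw : 0 < ‖H w‖ := norm_pos_iff.mpr (hH0 w hwt.le)
    rw [← div_le_iff₀ hHz, ← Real.log_le_iff_le_exp (by positivity),
      Real.log_div hHw.ne' hHz.ne', hHlog w hwt.le, hHlog z hz0]
    have h1 : Real.log ‖G w‖ - Real.log ‖G z‖ ≤ 1 / 2 := by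
      refine (le_abs_self _).trans ((abs_log_norm_sub_log_norm_le hrR hG hG0 hz
        (by rw [hwt]; linarith)).trans ?_)
      rw [hwt, ← hL]
      have : 4 * R * t / (R - r) ^ 2 * L = 2 * t * (2 * R * L / (R - r) ^ 2) := by
        field_simp
        ring
      rw [this]
      nlinarith
    have h2 : ∀ a ∈ s, D a * Real.log ‖w - a‖ - D a * Real.log ‖z - a‖ ≤
        2 * t * (|(D a : ℝ)| / ‖z - a‖) := by
      intro a ha
      have hz1 := hza a ha
      have hw1 : 0 < ‖w - a‖ := norm_pos_iff.mpr (hwa w hwt.le a ha)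
      have h3 : |‖w - a‖ / ‖z - a‖ - 1| ≤ t / ‖z - a‖ := by
        have : ‖w - a‖ / ‖z - a‖ - 1 = (‖w - a‖ - ‖z - a‖) / ‖z - a‖ := by field_simp
        rw [this, abs_div, abs_of_pos hz1]
        gcongr
        refine (abs_norm_sub_norm_le _ _).trans_eq ?_
        rw [← hwt]
        congr 1
        ring
      have h4 : t / ‖z - a‖ ≤ 1 / 2 := by
        rw [div_le_iff₀ hz1]
        linarith [hta a ha]
      have h5 := abs_log_le_two_mul (h3.trans h4)
      rw [← mul_sub, ← Real.log_div hw1.ne' hz1.ne']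
      calc (D a : ℝ) * Real.log (‖w - a‖ / ‖z - a‖)
          ≤ |(D a : ℝ)| * |Real.log (‖w - a‖ / ‖z - a‖)| := by
            rw [← abs_mul]; exact le_abs_self _
        _ ≤ |(D a : ℝ)| * (2 * (t / ‖z - a‖)) := by
            gcongr
            linarith
        _ = 2 * t * (|(D a : ℝ)| / ‖z - a‖) := by ring
    have h3 : ∑ a ∈ s, (D a * Real.log ‖w - a‖ - D a * Real.log ‖z - a‖) ≤ 1 / 2 := by
      refine (Finset.sum_le_sum h2).trans ?_
      rw [← Finset.mul_sum]
      nlinarith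
    rw [Finset.sum_sub_distrib] at h3
    linarith
  have hdiff : DiffContOnCl ℂ H (Metric.ball z t) := by
    apply DifferentiableOn.diffContOnCl
    rw [closure_ball z ht0.ne']
    intro w hw
    rw [mem_closedBall_iff_norm] at hw
    apply DifferentiableAt.differentiableWithinAt
    apply DifferentiableAt.mul
    · apply DifferentiableAt.fun_finsetProd
      intro a ha
      exact (differentiableAt_id.sub_const a).zpow (Or.inl (hwa w hw a ha))
    · exact (hG w (hin w hw)).differentiableAt
  have hcauchy := Complex.norm_iteratedDeriv_le_of_forall_mem_sphere_norm_le i ht0 hdiff hbound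
  rw [norm_div, div_le_iff₀ hHz]
  refine hcauchy.trans_eq ?_
  have : t ^ i = ((4 * X) ^ i)⁻¹ := by rw [ht, one_div, inv_pow]
  rw [this, div_inv_eq_mul]
  ring

end HoloCurve
end

noncomputable section

namespace HoloCurve

/-! ### The lemma on the logarithmic derivative -/

open Function.locallyFinsuppWithin in
-- A point `a ≠ 0` of the disc of radius `R` has weight `log (R' / ‖a‖) ≥ log (R' / R)` in the
-- counting function at `R'`; at the origin the weight is `log R'`, and `R ≥ 1` is needed. This
-- bounds the number of zeros and poles by the characteristic.
theorem sum_mul_log_div_le_logCounting {D : Function.locallyFinsupp ℂ ℤ} (hD : 0 ≤ D) {R R' : ℝ}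
    (hR : 1 ≤ R) (hRR' : R < R') (s : Finset ℂ) (hs : ∀ a ∈ s, ‖a‖ ≤ R) :
    (∑ a ∈ s, (D a : ℝ)) * Real.log (R' / R) ≤ Function.locallyFinsuppWithin.logCounting D R' := by
  classical
  have hR0 : 0 < R := by linarith
  have hR'0 : 0 < R' := by linarith
  have hD0 : ∀ a, (0 : ℝ) ≤ D a := fun a => by exact_mod_cast hD a
  have hmem : ∀ a : ℂ, ‖a‖ ≤ R' → toClosedBall R' D a = D a := by
    intro a ha
    apply toClosedBall_eval_within
    rw [mem_closedBall_zero_iff, abs_of_pos hR'0]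
    exact ha
  have hfin : (toClosedBall R' D).support.Finite :=
    (toClosedBall R' D).finiteSupport (isCompact_closedBall 0 |R'|)
  have hsub : (Function.support fun z : ℂ => (toClosedBall R' D z : ℝ) * Real.log (R' * ‖z‖⁻¹)) ⊆
      ((hfin.toFinset ∪ s : Finset ℂ) : Set ℂ) := by
    intro z hz
    have : (toClosedBall R' D) z ≠ 0 := by
      intro h0
      simp [h0] at hz
    simp [this]
  have hexp : Function.locallyFinsuppWithin.logCounting D R' =
      ∑ z ∈ hfin.toFinset ∪ s, (toClosedBall R' D z : ℝ) * Real.log (R' * ‖z‖⁻¹) +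
        D 0 * Real.log R' := by
    rw [← finsum_eq_sum_of_support_subset _ hsub]
    rfl
  have hterm : ∀ z ∈ hfin.toFinset ∪ s,
      0 ≤ (toClosedBall R' D z : ℝ) * Real.log (R' * ‖z‖⁻¹) := by
    intro z _
    by_cases hz : ‖z‖ ≤ R'
    · rw [hmem z hz]
      apply mul_nonneg (hD0 z)
      rcases (norm_nonneg z).eq_or_lt with h0 | h0
      · simp [← h0]
      · apply Real.log_nonneg
        rw [← div_eq_mul_inv, one_le_div h0]
        exact hz
    · have : toClosedBall R' D z = 0 := by
        apply Function.locallyFinsuppWithin.apply_eq_zero_of_notMem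
        rw [mem_closedBall_zero_iff, abs_of_pos hR'0]
        exact hz
      simp [this]
  have h1 : ∑ a ∈ s, (D a : ℝ) * Real.log (R' / R) ≤
      ∑ a ∈ s, ((D a : ℝ) * Real.log (R' * ‖a‖⁻¹) + if a = 0 then (D 0 : ℝ) * Real.log R' else 0) := by
    apply Finset.sum_le_sum
    intro a ha
    by_cases h0 : a = 0
    -- The general weight at the origin evaluates to `log 0 = 0`; the separate term `D 0 * log R'`
    -- compensates.
    · rw [h0]
      simp only [norm_zero, inv_zero, mul_zero, Real.log_zero, if_true, zero_add]
      apply mul_le_mul_of_nonneg_left _ (hD0 0)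
      exact Real.log_le_log (by positivity) (div_le_self hR'0.le hR)
    · rw [if_neg h0, add_zero]
      apply mul_le_mul_of_nonneg_left _ (hD0 a)
      have := norm_pos_iff.mpr h0
      have := hs a ha
      apply Real.log_le_log (by positivity)
      rw [← div_eq_mul_inv]
      gcongr
  have h2 : ∑ a ∈ s, (if a = 0 then (D 0 : ℝ) * Real.log R' else 0) ≤ D 0 * Real.log R' := by
    rw [Finset.sum_ite_eq']
    have : 0 ≤ (D 0 : ℝ) * Real.log R' := mul_nonneg (hD0 0) (Real.log_nonneg (by linarith))
    split_ifs <;> linarith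
  have h3 : ∑ a ∈ s, (D a : ℝ) * Real.log (R' * ‖a‖⁻¹) ≤
      ∑ z ∈ hfin.toFinset ∪ s, (toClosedBall R' D z : ℝ) * Real.log (R' * ‖z‖⁻¹) := by
    refine le_trans (le_of_eq ?_) (Finset.sum_le_sum_of_subset_of_nonneg Finset.subset_union_right
      fun z hz _ => hterm z hz)
    apply Finset.sum_congr rfl
    intro a ha
    rw [hmem a ((hs a ha).trans hRR'.le)]
  rw [Finset.sum_mul, hexp]
  rw [Finset.sum_add_distrib] at h1
  linarith

/-- If `x ≤ M` and `M ≥ 0`, then `|x| ≤ 2M - x`. Take `M = log (2R)` and use that `log ‖z - a‖` has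
average exactly `log R`. -/
theorem circleAverage_abs_log_norm_sub_le (a : ℂ) {R : ℝ} (hR : 1 ≤ R) (ha : ‖a‖ ≤ R) :
    Real.circleAverage (fun z => |Real.log ‖z - a‖|) 0 R ≤ Real.log (4 * R) := by
  have hR0 : 0 < R := by linarith
  have hint : CircleIntegrable (fun z => Real.log ‖z - a‖) 0 R := by
    apply MeromorphicOn.circleIntegrable_log_norm
    intro z _
    fun_prop
  have havg : Real.circleAverage (fun z => Real.log ‖z - a‖) 0 R = Real.log R :=
    circleAverage_log_norm_sub_const_of_mem_closedBall
      (by rw [mem_closedBall_zero_iff, abs_of_pos hR0]; exact ha)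
  have hle : Real.circleAverage (fun z => |Real.log ‖z - a‖|) 0 R ≤
      Real.circleAverage (fun z => 2 * Real.log (2 * R) - Real.log ‖z - a‖) 0 R := by
    refine Real.circleAverage_mono hint.abs ((circleIntegrable_const _ _ _).sub hint) ?_
    intro z hz
    rw [abs_of_pos hR0, mem_sphere_zero_iff_norm] at hz
    have h2R : 0 ≤ Real.log (2 * R) := Real.log_nonneg (by linarith)
    have hup : Real.log ‖z - a‖ ≤ Real.log (2 * R) := by
      rcases (norm_nonneg (z - a)).eq_or_lt with h0 | h0
      · rw [← h0, Real.log_zero]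
        exact h2R
      · apply Real.log_le_log h0
        linarith [norm_sub_le z a]
    rw [abs_le]
    constructor <;> linarith
  refine hle.trans_eq ?_
  have : Real.circleAverage (fun z => 2 * Real.log (2 * R) - Real.log ‖z - a‖) 0 R =
      Real.circleAverage (fun _ => 2 * Real.log (2 * R)) 0 R -
        Real.circleAverage (fun z => Real.log ‖z - a‖) 0 R :=
    Real.circleAverage_sub (circleIntegrable_const _ _ _) hint
  rw [this, havg, Real.circleAverage_const, Real.log_mul (by norm_num) hR0.ne',
    Real.log_mul (by norm_num) hR0.ne', show (4 : ℝ) = 2 ^ 2 by norm_num, Real.log_pow]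
  push_cast
  ring

theorem meromorphic_iteratedDeriv {h : ℂ → ℂ} (hh : Meromorphic h) (i : ℕ) :
    Meromorphic (iteratedDeriv i h) := by
  induction i with
  | zero => simpa using hh
  | succ i ih => rw [iteratedDeriv_succ]; exact ih.deriv

theorem sqrt_add_le_sqrt_add_sqrt {x y : ℝ} (hx : 0 ≤ x) (hy : 0 ≤ y) :
    Real.sqrt (x + y) ≤ Real.sqrt x + Real.sqrt y := by
  rw [Real.sqrt_le_left (by positivity)]
  nlinarith [Real.sq_sqrt hx, Real.sq_sqrt hy, mul_nonneg (Real.sqrt_nonneg x) (Real.sqrt_nonneg y)]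

theorem posLog_add_posLog_inv (x : ℝ) : Real.posLog x + Real.posLog x⁻¹ = |Real.log x| := by
  rw [← Real.half_mul_log_add_log_abs, ← Real.half_mul_log_add_log_abs, Real.log_inv, abs_neg]
  ring

theorem sqrt_sum_le_sum_sqrt {ι : Type*} (s : Finset ι) (u : ι → ℝ) (hu : ∀ a ∈ s, 0 ≤ u a) :
    Real.sqrt (∑ a ∈ s, u a) ≤ ∑ a ∈ s, Real.sqrt (u a) := by
  classical
  induction s using Finset.induction_on with
  | empty => simp
  | insert a s ha ih =>
    rw [Finset.sum_insert ha, Finset.sum_insert ha]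
    have h1 := ih fun b hb => hu b (Finset.mem_insert_of_mem hb)
    refine (sqrt_add_le_sqrt_add_sqrt (hu a (Finset.mem_insert_self _ _))
      (Finset.sum_nonneg fun b hb => hu b (Finset.mem_insert_of_mem hb))).trans ?_
    linarith

theorem posLog_norm_le_log_bound {x X K : ℝ} {i : ℕ} (hx : 0 ≤ x) (hX : 0 ≤ X) (hK : 1 ≤ K)
    (h : x ≤ K * (4 * X) ^ i) {V : ℝ} (hV : 0 ≤ V) (hXV : Real.sqrt X ≤ V) :
    Real.posLog x ≤ Real.log (K * 4 ^ i) + 2 * i * Real.log (1 + V) := by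
  have hXle : X ≤ (1 + V) ^ 2 := by
    have := Real.sq_sqrt hX
    have := Real.sqrt_nonneg X
    nlinarith
  have h1 : x ≤ K * 4 ^ i * ((1 + V) ^ 2) ^ i := by
    refine h.trans ?_
    rw [mul_pow, ← mul_assoc]
    gcongr
  refine (Real.posLog_le_posLog hx h1).trans ?_
  have h2 : 1 ≤ K * 4 ^ i * ((1 + V) ^ 2) ^ i := by
    have e1 : (1 : ℝ) ≤ 4 ^ i := one_le_pow₀ (by norm_num)
    have e2 : 1 ≤ ((1 + V) ^ 2) ^ i := one_le_pow₀ (one_le_pow₀ (by linarith))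
    have e3 : 1 ≤ K * 4 ^ i := one_le_mul_of_one_le_of_one_le hK e1
    exact one_le_mul_of_one_le_of_one_le e3 e2
  rw [Real.posLog_eq_log (by rwa [abs_of_pos (by linarith)]), Real.log_mul (by positivity)
    (by positivity), ← pow_mul, Real.log_pow]
  push_cast
  linarith

/-- The bound for the proximity functions of the logarithmic derivatives of order `i` on the circle
of radius `r`, in terms of a bound `τ` for the characteristic on a circle of radius `R' > R > r`. -/
def logDerivBound (i : ℕ) (r R R' τ : ℝ) : ℝ :=
  Real.log (i.factorial * Real.exp 1 * 4 ^ i) + 2 * i * Real.log (1 +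
    (τ / Real.log (R' / R) * (sinAverage * (Real.sqrt r)⁻¹) + Real.sqrt (2 * R *
      (τ + Real.log (4 * R) * (τ / Real.log (R' / R))) / (R - r) ^ 2 + 1 / (R - r))))

/-- The radius `R` serves the Poisson formula and `R'` the count of zeros and poles. With `N` the
number of these in the disc of radius `R`, `N ≤ τ / log (R' / R)`, and the average of `|log ‖G‖|` is
at most `τ + N log (4R)`. These bound the average of a majorant of `√X` in
`norm_iteratedDeriv_div_le`, and concavity of the logarithm concludes. -/
theorem exists_circleAverage_posLog_iteratedDeriv_le {h : ℂ → ℂ} (hh : Meromorphic h)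
    (hh0 : ∀ z, meromorphicOrderAt h z ≠ ⊤) :
    ∃ C : ℝ, ∀ (i : ℕ) (r R R' τ : ℝ), 1 ≤ r → r < R → R < R' →
      2 * ValueDistribution.characteristic h ⊤ R + C ≤ τ →
      2 * ValueDistribution.characteristic h ⊤ R' + C ≤ τ →
      Real.circleAverage (fun z => Real.posLog ‖iteratedDeriv i h z / h z‖) 0 r ≤
        logDerivBound i r R R' τ := by
  -- By Jensen's formula, `2 T(h) + C` with this `C` equals `T(h) + T(1/h)`, which controls zeros
  -- and poles and the average of `|log ‖h‖|` together.
  refine ⟨-Real.log ‖meromorphicTrailingCoeffAt h 0‖, ?_⟩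
  intro i r R R' τ hr hrR hRR' hτR hτR'
  have hr0 : 0 < r := by linarith
  have hR0 : 0 < R := by linarith
  have hR'0 : 0 < R' := by linarith
  have hRr : 0 < R - r := by linarith
  have hlog : 0 < Real.log (R' / R) := Real.log_pos ((one_lt_div hR0).mpr hRR')
  set U : Set ℂ := Metric.closedBall 0 R with hU
  have hmU : MeromorphicOn h U := fun z _ => hh z
  set D := MeromorphicOn.divisor h U with hDdef
  have hDfin : D.support.Finite := D.finiteSupport (isCompact_closedBall 0 R)
  obtain ⟨G, hG, hG0', heq⟩ := hmU.extract_zeros_poles (fun u => hh0 u) hDfin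
  have hG0 : ∀ z ∈ U, G z ≠ 0 := fun z hz => hG0' ⟨z, hz⟩
  set s := hDfin.toFinset with hs
  have hDs : ∀ a ∈ s, D a ≠ 0 := fun a ha => by simpa [hs] using ha
  have hsU : ∀ a ∈ s, ‖a‖ ≤ R := by
    intro a ha
    have := D.supportWithinDomain (hDfin.mem_toFinset.mp ha)
    simpa [hU] using this
  set H : ℂ → ℂ := fun w => (∏ a ∈ s, (w - a) ^ D a) * G w with hH
  have hprod : ((∏ᶠ u : ℂ, (fun x => x - u) ^ D u) • G) = H := by
    have hms : (Function.mulSupport fun u : ℂ => (fun x : ℂ => x - u) ^ D u) ⊆ (s : Set ℂ) := by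
      rw [Function.FactorizedRational.mulSupport]
      simp [hs]
    rw [finprod_eq_prod_of_mulSupport_subset _ hms]
    funext w
    simp [hH, Finset.prod_apply]
  rw [hprod] at heq
  -- the counting estimate
  set N := ∑ a ∈ s, |(D a : ℝ)| with hN
  have hN0 : 0 ≤ N := Finset.sum_nonneg fun a _ => abs_nonneg _
  have hfmt : ∀ ρ : ℝ, ρ ≠ 0 → ValueDistribution.characteristic h⁻¹ ⊤ ρ =
      ValueDistribution.characteristic h ⊤ ρ - Real.log ‖meromorphicTrailingCoeffAt h 0‖ := by
    intro ρ hρ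
    linarith [ValueDistribution.characteristic_sub_characteristic_inv_of_ne_zero hh hρ]
  have hprox0 : ∀ (g : ℂ → ℂ) (ρ : ℝ), 0 ≤ ValueDistribution.proximity g ⊤ ρ := fun g ρ =>
    ValueDistribution.proximity_nonneg ρ
  have hcount0 : ∀ (g : ℂ → ℂ) (ρ : ℝ), 1 ≤ ρ → 0 ≤ ValueDistribution.logCounting g ⊤ ρ :=
    fun g ρ hρ => ValueDistribution.logCounting_nonneg hρ
  have hchar : ∀ (g : ℂ → ℂ) (ρ : ℝ), ValueDistribution.characteristic g ⊤ ρ =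
      ValueDistribution.proximity g ⊤ ρ + ValueDistribution.logCounting g ⊤ ρ := fun g ρ => rfl
  have hNle : N ≤ τ / Real.log (R' / R) := by
    rw [le_div_iff₀ hlog]
    set E := MeromorphicOn.divisor h Set.univ with hE
    have hDE : ∀ a ∈ s, D a = E a := by
      intro a ha
      rw [hDdef, hE, MeromorphicOn.divisor_apply hmU (by simpa [hU] using hsU a ha),
        MeromorphicOn.divisor_apply (fun z _ => hh z) (Set.mem_univ a)]
    have h1 := sum_mul_log_div_le_logCounting (D := E⁺) (posPart_nonneg _) (by linarith) hRR' s hsU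
    have h2 := sum_mul_log_div_le_logCounting (D := E⁻) (negPart_nonneg _) (by linarith) hRR' s hsU
    have h3 : N = ∑ a ∈ s, ((E⁺ a : ℤ) : ℝ) + ∑ a ∈ s, ((E⁻ a : ℤ) : ℝ) := by
      rw [← Finset.sum_add_distrib]
      apply Finset.sum_congr rfl
      intro a ha
      rw [hDE a ha]
      have : |E a| = (E⁺) a + (E⁻) a := by
        rw [Function.locallyFinsuppWithin.posPart_apply, Function.locallyFinsuppWithin.negPart_apply,
          posPart_add_negPart]
      exact_mod_cast this
    rw [h3, add_mul]
    rw [← ValueDistribution.logCounting_zero] at h1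
    rw [← ValueDistribution.logCounting_top] at h2
    rw [← ValueDistribution.logCounting_inv] at h1
    have h4 := hfmt R' hR'0.ne'
    have h5 := hchar h R'
    have h6 := hchar h⁻¹ R'
    linarith [hprox0 h R', hprox0 h⁻¹ R']
  -- the average of `|log ‖G‖|`
  set L := Real.circleAverage (fun ξ => |Real.log ‖G ξ‖|) 0 R with hL
  have hsphere : Metric.sphere (0 : ℂ) |R| ⊆ U := by
    rw [abs_of_pos hR0]
    exact Metric.sphere_subset_closedBall
  have hintG : CircleIntegrable (fun ξ => |Real.log ‖G ξ‖|) 0 R := by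
    apply CircleIntegrable.abs
    apply MeromorphicOn.circleIntegrable_log_norm
    intro z hz
    exact (hG z (hsphere hz)).meromorphicAt
  have hinth : CircleIntegrable (fun ξ => |Real.log ‖h ξ‖|) 0 R := by
    apply CircleIntegrable.abs
    apply MeromorphicOn.circleIntegrable_log_norm
    exact fun z _ => hh z
  have hinta : ∀ a : ℂ, CircleIntegrable (fun ξ => |(D a : ℝ)| * |Real.log ‖ξ - a‖|) 0 R := by
    intro a
    have : CircleIntegrable (fun ξ => |Real.log ‖ξ - a‖|) 0 R := by
      apply CircleIntegrable.abs
      apply MeromorphicOn.circleIntegrable_log_norm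
      intro z _
      fun_prop
    exact this.const_mul _
  have hscod : ∀ᶠ z in codiscreteWithin U, z ∉ s := by
    exact compl_finite_mem_codiscreteWithin s.finite_toSet
  have hLle : L ≤ τ + Real.log (4 * R) * (τ / Real.log (R' / R)) := by
    have h1 : L ≤ Real.circleAverage (fun ξ => |Real.log ‖h ξ‖| +
        ∑ a ∈ s, |(D a : ℝ)| * |Real.log ‖ξ - a‖|) 0 R := by
      apply circleAverage_mono_codiscreteWithin hR0.ne' hintG
      · exact hinth.add (CircleIntegrable.fun_sum _ fun a _ => hinta a)
      · have hle : codiscreteWithin (Metric.sphere (0 : ℂ) |R|) ≤ codiscreteWithin U :=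
          codiscreteWithin_mono hsphere
        filter_upwards [hle heq, hle hscod, self_mem_codiscreteWithin (Metric.sphere (0 : ℂ) |R|)]
          with ξ hξ hξs hξR
        have hne : ∀ a ∈ s, ‖ξ - a‖ ^ D a ≠ 0 := fun a ha =>
          zpow_ne_zero _ (norm_ne_zero_iff.mpr (sub_ne_zero.mpr fun h => hξs (h ▸ ha)))
        have hlogh : Real.log ‖h ξ‖ = ∑ a ∈ s, D a * Real.log ‖ξ - a‖ + Real.log ‖G ξ‖ := by
          rw [hξ]
          simp only [hH]
          rw [norm_mul, norm_prod]
          simp_rw [norm_zpow]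
          rw [Real.log_mul (Finset.prod_ne_zero_iff.mpr hne)
            (norm_ne_zero_iff.mpr (hG0 ξ (hsphere hξR))), Real.log_prod hne]
          simp_rw [Real.log_zpow]
        have hG' : Real.log ‖G ξ‖ = Real.log ‖h ξ‖ - ∑ a ∈ s, D a * Real.log ‖ξ - a‖ := by
          linarith
        rw [hG']
        refine (abs_sub _ _).trans ?_
        gcongr
        refine (Finset.abs_sum_le_sum_abs _ _).trans_eq ?_
        simp_rw [abs_mul]
    rw [Real.circleAverage_fun_add hinth (CircleIntegrable.fun_sum _ fun a _ => hinta a),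
      Real.circleAverage_fun_sum fun a _ => hinta a] at h1
    have h2 : ∑ a ∈ s, Real.circleAverage (fun ξ => |(D a : ℝ)| * |Real.log ‖ξ - a‖|) 0 R ≤
        N * Real.log (4 * R) := by
      rw [hN, Finset.sum_mul]
      apply Finset.sum_le_sum
      intro a ha
      have : Real.circleAverage (fun ξ => |(D a : ℝ)| * |Real.log ‖ξ - a‖|) 0 R =
          |(D a : ℝ)| * Real.circleAverage (fun ξ => |Real.log ‖ξ - a‖|) 0 R := by
        simpa using Real.circleAverage_fun_smul (a := |(D a : ℝ)|)
          (f := fun ξ => |Real.log ‖ξ - a‖|) (c := 0) (R := R)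
      rw [this]
      exact mul_le_mul_of_nonneg_left
        (circleAverage_abs_log_norm_sub_le a (by linarith) (hsU a ha)) (abs_nonneg _)
    have h3 : Real.circleAverage (fun ξ => |Real.log ‖h ξ‖|) 0 R ≤ τ := by
      have e1 : (fun ξ => |Real.log ‖h ξ‖|) = fun ξ =>
          Real.posLog ‖h ξ‖ + Real.posLog ‖h⁻¹ ξ‖ := by
        funext ξ
        rw [Pi.inv_apply, norm_inv]
        exact (posLog_add_posLog_inv _).symm
      have hi1 : CircleIntegrable (fun ξ => Real.posLog ‖h ξ‖) 0 R :=
        MeromorphicOn.circleIntegrable_posLog_norm fun z _ => hh z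
      have hi2 : CircleIntegrable (fun ξ => Real.posLog ‖h⁻¹ ξ‖) 0 R :=
        MeromorphicOn.circleIntegrable_posLog_norm fun z _ => (hh z).inv
      rw [e1, Real.circleAverage_fun_add hi1 hi2]
      have h4 := hfmt R hR0.ne'
      have h5 := hchar h R
      have h6 := hchar h⁻¹ R
      rw [ValueDistribution.proximity_top] at h5 h6
      linarith [hcount0 h R (by linarith), hcount0 h⁻¹ R (by linarith)]
    have h4R : 0 ≤ Real.log (4 * R) := Real.log_nonneg (by linarith)
    have h5 := mul_le_mul_of_nonneg_left hNle h4R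
    linarith
  have hL0 : 0 ≤ L := Real.circleAverage_nonneg_of_nonneg fun _ _ => abs_nonneg _
  -- the pointwise bound
  set Y := 2 * R * L / (R - r) ^ 2 + 1 / (R - r) with hY
  have hY0 : 0 ≤ Y := by positivity
  set V : ℂ → ℝ := fun z => ∑ a ∈ s, |(D a : ℝ)| * (Real.sqrt ‖z - a‖)⁻¹ + Real.sqrt Y with hV
  have hV0 : ∀ z, 0 ≤ V z := fun z => by
    have : 0 ≤ ∑ a ∈ s, |(D a : ℝ)| * (Real.sqrt ‖z - a‖)⁻¹ :=
      Finset.sum_nonneg fun a _ => by positivity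
    positivity
  have hVa : ∀ a ∈ s, CircleIntegrable (fun z => |(D a : ℝ)| * (Real.sqrt ‖z - a‖)⁻¹) 0 r :=
    fun a _ => (circleIntegrable_inv_sqrt_norm_sub a hr0).const_mul _
  have hVint : CircleIntegrable V 0 r :=
    (CircleIntegrable.fun_sum _ hVa).add (circleIntegrable_const _ _ _)
  have hVavg : Real.circleAverage V 0 r ≤ N * (sinAverage * (Real.sqrt r)⁻¹) + Real.sqrt Y := by
    rw [hV, Real.circleAverage_fun_add (CircleIntegrable.fun_sum _ hVa)
      (circleIntegrable_const _ _ _), Real.circleAverage_const, Real.circleAverage_fun_sum hVa]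
    gcongr
    rw [hN, Finset.sum_mul]
    apply Finset.sum_le_sum
    intro a _
    have : Real.circleAverage (fun z => |(D a : ℝ)| * (Real.sqrt ‖z - a‖)⁻¹) 0 r =
        |(D a : ℝ)| * Real.circleAverage (fun z => (Real.sqrt ‖z - a‖)⁻¹) 0 r := by
      simpa using Real.circleAverage_fun_smul (a := |(D a : ℝ)|)
        (f := fun z => (Real.sqrt ‖z - a‖)⁻¹) (c := 0) (R := r)
    rw [this]
    exact mul_le_mul_of_nonneg_left (circleAverage_inv_sqrt_norm_sub_le a hr0) (abs_nonneg _)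
  -- Derivatives require equality near a point; equality off a discrete set provides this at all but
  -- discretely many points.
  have hnear : ∀ᶠ z in codiscreteWithin (Metric.sphere (0 : ℂ) |r|), h =ᶠ[nhds z] H := by
    rw [Filter.Eventually, mem_codiscreteWithin]
    intro x hx
    rw [disjoint_principal_right]
    have hxb : x ∈ Metric.ball (0 : ℂ) R := by
      rw [abs_of_pos hr0, mem_sphere_zero_iff_norm] at hx
      rw [mem_ball_zero_iff, hx]
      exact hrR
    have h1 := (mem_codiscreteWithin.mp heq) x (Metric.ball_subset_closedBall hxb)
    rw [disjoint_principal_right] at h1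
    have hUx : U ∈ nhdsWithin x {x}ᶜ :=
      mem_nhdsWithin_of_mem_nhds (Filter.mem_of_superset (Metric.isOpen_ball.mem_nhds hxb)
        Metric.ball_subset_closedBall)
    have h2 : ∀ᶠ w in nhdsWithin x {x}ᶜ, h w = H w := by
      filter_upwards [h1, hUx] with w hw hwU
      by_contra hne
      exact hw ⟨hwU, hne⟩
    have h3 := eventually_eventually_nhdsWithin.mpr h2
    filter_upwards [h3, self_mem_nhdsWithin] with w hw hwx hcon
    apply hcon.2
    rwa [isOpen_compl_singleton.nhdsWithin_eq hwx] at hw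
  have hscod' : ∀ᶠ z in codiscreteWithin (Metric.sphere (0 : ℂ) |r|), z ∉ s :=
    compl_finite_mem_codiscreteWithin s.finite_toSet
  have hK : (1 : ℝ) ≤ i.factorial * Real.exp 1 :=
    one_le_mul_of_one_le_of_one_le (by exact_mod_cast Nat.one_le_iff_ne_zero.mpr i.factorial_ne_zero)
      (Real.one_le_exp zero_le_one)
  have hpt : ∀ᶠ z in codiscreteWithin (Metric.sphere (0 : ℂ) |r|),
      Real.posLog ‖iteratedDeriv i h z / h z‖ ≤
        Real.log (i.factorial * Real.exp 1 * 4 ^ i) + 2 * i * Real.log (1 + V z) := by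
    filter_upwards [hnear, hscod', self_mem_codiscreteWithin (Metric.sphere (0 : ℂ) |r|)]
      with z hz hzs hzr
    rw [abs_of_pos hr0, mem_sphere_zero_iff_norm] at hzr
    have hbd := norm_iteratedDeriv_div_le hrR hG hG0 s D hDs hzr.le hzs rfl i
    rw [hz.iteratedDeriv_eq, hz.eq_of_nhds]
    have hsum0 : ∀ a ∈ s, 0 ≤ |(D a : ℝ)| / ‖z - a‖ := fun a _ => by positivity
    refine posLog_norm_le_log_bound (norm_nonneg _) (add_nonneg (Finset.sum_nonneg hsum0) hY0)
      hK hbd (hV0 z) ?_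
    refine (sqrt_add_le_sqrt_add_sqrt (Finset.sum_nonneg hsum0) hY0).trans ?_
    simp only [hV]
    gcongr
    refine (sqrt_sum_le_sum_sqrt s _ hsum0).trans (Finset.sum_le_sum fun a ha => ?_)
    rw [Real.sqrt_div (abs_nonneg _), div_eq_mul_inv]
    have hD1 : 1 ≤ |(D a : ℝ)| := by exact_mod_cast Int.one_le_abs (hDs a ha)
    gcongr
    rw [Real.sqrt_le_left (by positivity)]
    nlinarith
  have huint : CircleIntegrable (fun z => Real.posLog ‖iteratedDeriv i h z / h z‖) 0 r :=
    MeromorphicOn.circleIntegrable_posLog_norm (f := fun z => iteratedDeriv i h z / h z)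
      fun z _ => (meromorphic_iteratedDeriv hh i z).div (hh z)
  have hsin := sinAverage_nonneg
  have hM := circleAverage_le_of_le_log_one_add hr0.ne' huint hVint hV0 (K := 2 * i) (by positivity)
    (M := 1 + (N * (sinAverage * (Real.sqrt r)⁻¹) + Real.sqrt Y)) (by positivity)
    (by linarith) hpt
  refine hM.trans ?_
  have hYle : Y ≤ 2 * R * (τ + Real.log (4 * R) * (τ / Real.log (R' / R))) / (R - r) ^ 2 +
      1 / (R - r) := by
    rw [hY]
    gcongr
  unfold logDerivBound
  gcongr

end HoloCurve
end

noncomputable section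

namespace HoloCurve

/-! ### Growth lemmas -/

/-- Borel's growth lemma. -/
theorem volume_setOf_two_mul_le_lt_top {T : ℝ → ℝ} {r₀ : ℝ} (hT : MonotoneOn T (Set.Ici r₀))
    (hT1 : ∀ r, r₀ ≤ r → 1 ≤ T r) :
    volume {r | r₀ ≤ r ∧ 2 * T r ≤ T (r + 1 / T r)} < ⊤ := by
  set E := {r | r₀ ≤ r ∧ 2 * T r ≤ T (r + 1 / T r)} with hE
  have hsub : E ⊆ ⋃ k : ℕ, {r | r ∈ E ∧ (2 : ℝ) ^ k ≤ T r ∧ T r < 2 ^ (k + 1)} := by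
    intro r hr
    obtain ⟨k, hk1, hk2⟩ := exists_nat_pow_near (hT1 r hr.1) (one_lt_two)
    exact Set.mem_iUnion.mpr ⟨k, hr, hk1, hk2⟩
  -- From a point of `E` with `T r ≥ 2 ^ k`, an advance by `1 / T r ≤ 2 ^ (-k)` doubles `T`, so the
  -- part of `E` at level `k` has diameter at most `2 ^ (-k)`.
  have hkey : ∀ k : ℕ, ∀ r ∈ E, ∀ r' ∈ E, (2 : ℝ) ^ k ≤ T r → T r' < 2 ^ (k + 1) →
      r' ≤ r + (2⁻¹) ^ k := by
    intro k r hr r' hr' h1 h2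
    by_contra! hlt
    have hpos : (0 : ℝ) < 2 ^ k := by positivity
    have h3 : r + 1 / T r ≤ r' := by
      have : 1 / T r ≤ 1 / 2 ^ k := by gcongr
      rw [inv_pow, ← one_div] at hlt
      linarith
    have h0 : 0 ≤ 1 / T r := by
      have := hT1 r hr.1
      positivity
    have h4 := hT (a := r + 1 / T r) (b := r') (Set.mem_Ici.mpr (by linarith [hr.1])) hr'.1 h3
    have h5 := hr.2
    rw [pow_succ] at h2
    linarith
  have hvol : ∀ k : ℕ, volume {r | r ∈ E ∧ (2 : ℝ) ^ k ≤ T r ∧ T r < 2 ^ (k + 1)} ≤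
      (2⁻¹ : ENNReal) ^ k := by
    intro k
    refine (Real.volume_le_diam _).trans ?_
    refine Metric.ediam_le fun r hr r' hr' => ?_
    have h1 := hkey k r hr.1 r' hr'.1 hr.2.1 hr'.2.2
    have h2 := hkey k r' hr'.1 r hr.1 hr'.2.1 hr.2.2
    rw [edist_dist, Real.dist_eq]
    have h3 : |r - r'| ≤ (2⁻¹ : ℝ) ^ k := by
      rw [abs_le]
      constructor <;> linarith
    refine (ENNReal.ofReal_le_ofReal h3).trans_eq ?_
    rw [ENNReal.ofReal_pow (by norm_num), ENNReal.ofReal_inv_of_pos (by norm_num)]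
    norm_num
  calc volume E ≤ _ := measure_mono hsub
    _ ≤ ∑' k : ℕ, volume {r | r ∈ E ∧ (2 : ℝ) ^ k ≤ T r ∧ T r < 2 ^ (k + 1)} := measure_iUnion_le _
    _ ≤ ∑' k : ℕ, (2⁻¹ : ENNReal) ^ k := ENNReal.tsum_le_tsum hvol
    _ < ⊤ := by
      rw [ENNReal.tsum_geometric]
      simp

/-- Chord inequality, on `0 ≤ log r ≤ log s`, for the convex function `x ↦ max 0 (x + log c)`. -/
theorem posLog_convexity {c r s : ℝ} (hc : 0 ≤ c) (hr : 1 ≤ r) (hrs : r ≤ s) :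
    Real.log s * (Real.posLog (r * c) - Real.posLog c) ≤
      Real.log r * (Real.posLog (s * c) - Real.posLog c) := by
  rcases hc.eq_or_lt with rfl | hc
  · simp
  have hr0 : 0 < r := by linarith
  have hs0 : 0 < s := by linarith
  have hx : 0 ≤ Real.log r := Real.log_nonneg hr
  have hxy : Real.log r ≤ Real.log s := Real.log_le_log hr0 hrs
  unfold Real.posLog
  rw [Real.log_mul hr0.ne' hc.ne', Real.log_mul hs0.ne' hc.ne']
  generalize Real.log r = x at *
  generalize Real.log s = y at *
  generalize Real.log c = γ at *
  rcases le_total 0 γ with hγ | hγ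
  · rw [max_eq_right (by linarith), max_eq_right hγ, max_eq_right (by linarith)]
    linarith
  · rw [max_eq_left hγ, sub_zero, sub_zero]
    rcases le_total (x + γ) 0 with h1 | h1
    · rw [max_eq_left h1, mul_zero]
      exact mul_nonneg hx (le_max_left _ _)
    · rw [max_eq_right h1, max_eq_right (by linarith)]
      nlinarith

open Function.locallyFinsuppWithin in
-- For all `r ≤ s` the sum has the same index set, because `log⁺` kills the points outside the disc
-- of radius `r`; counting functions at different radii can then be compared termwise.
theorem logCounting_eq_sum_posLog (D : Function.locallyFinsupp ℂ ℤ) {r s : ℝ} (hr : 0 < r)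
    (hrs : r ≤ s) :
    Function.locallyFinsuppWithin.logCounting D r =
      ∑ z ∈ ((toClosedBall s D).finiteSupport (isCompact_closedBall 0 |s|)).toFinset,
        (D z : ℝ) * Real.posLog (r * ‖z‖⁻¹) + D 0 * Real.log r := by
  have hs : 0 < s := hr.trans_le hrs
  have hmem : ∀ ρ : ℝ, 0 < ρ → ∀ a : ℂ, ‖a‖ ≤ ρ → toClosedBall ρ D a = D a := by
    intro ρ hρ a ha
    apply toClosedBall_eval_within
    rw [mem_closedBall_zero_iff, abs_of_pos hρ]
    exact ha
  have hnot : ∀ ρ : ℝ, 0 < ρ → ∀ a : ℂ, ¬ ‖a‖ ≤ ρ → toClosedBall ρ D a = 0 := by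
    intro ρ hρ a ha
    apply Function.locallyFinsuppWithin.apply_eq_zero_of_notMem
    rw [mem_closedBall_zero_iff, abs_of_pos hρ]
    exact ha
  have hterm : ∀ z : ℂ, (toClosedBall r D z : ℝ) * Real.log (r * ‖z‖⁻¹) =
      (toClosedBall s D z : ℝ) * Real.posLog (r * ‖z‖⁻¹) := by
    intro z
    rcases (norm_nonneg z).eq_or_lt with h0 | h0
    · simp [← h0]
    by_cases hz : ‖z‖ ≤ r
    · rw [hmem r hr z hz, hmem s hs z (hz.trans hrs), Real.posLog_eq_log]
      rw [abs_of_pos (by positivity), ← div_eq_mul_inv, one_le_div h0]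
      exact hz
    · rw [hnot r hr z hz, (Real.posLog_eq_zero_iff _).mpr]
      · simp
      · rw [abs_of_pos (by positivity), ← div_eq_mul_inv, div_le_one h0]
        linarith
  set S := ((toClosedBall s D).finiteSupport (isCompact_closedBall 0 |s|)).toFinset with hS
  have hdef : Function.locallyFinsuppWithin.logCounting D r =
      (∑ᶠ z : ℂ, (toClosedBall r D z : ℝ) * Real.log (r * ‖z‖⁻¹)) + D 0 * Real.log r := rfl
  rw [hdef, finsum_congr hterm, finsum_eq_sum_of_support_subset (s := S)]
  · congr 1
    apply Finset.sum_congr rfl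
    intro z hz
    have hne : toClosedBall s D z ≠ 0 := by simpa [hS] using hz
    by_cases hzs : ‖z‖ ≤ s
    · rw [hmem s hs z hzs]
    · exact absurd (hnot s hs z hzs) hne
  · intro z hz
    have : toClosedBall s D z ≠ 0 := by
      intro h0
      simp [h0] at hz
    simp [hS, this]

/-- The counting function of an effective divisor is a convex function of `log r`. -/
theorem logCounting_convexity {D : Function.locallyFinsupp ℂ ℤ} (hD : 0 ≤ D) {r s : ℝ}
    (hr : 1 ≤ r) (hrs : r ≤ s) :
    Real.log s * (Function.locallyFinsuppWithin.logCounting D r -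
        Function.locallyFinsuppWithin.logCounting D 1) ≤
      Real.log r * (Function.locallyFinsuppWithin.logCounting D s -
        Function.locallyFinsuppWithin.logCounting D 1) := by
  have hr0 : 0 < r := by linarith
  rw [logCounting_eq_sum_posLog D hr0 hrs, logCounting_eq_sum_posLog D one_pos (hr.trans hrs),
    logCounting_eq_sum_posLog D (hr0.trans_le hrs) le_rfl]
  simp only [Real.log_one, mul_zero, add_zero, one_mul]
  rw [add_sub_right_comm, add_sub_right_comm, ← Finset.sum_sub_distrib, ← Finset.sum_sub_distrib,
    mul_add, mul_add, Finset.mul_sum, Finset.mul_sum]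
  apply add_le_add
  · apply Finset.sum_le_sum
    intro z _
    have hDz : (0 : ℝ) ≤ D z := by exact_mod_cast hD z
    have := mul_le_mul_of_nonneg_left (posLog_convexity (inv_nonneg.mpr (norm_nonneg z)) hr hrs) hDz
    linarith
  · linarith

/-- By Cartan's identity the characteristic is, up to a constant, the average over unimodular `a` of
the counting functions of `a`-points, which are convex in `log r`. -/
theorem characteristic_convexity {h : ℂ → ℂ} (hh : Meromorphic h) {r s : ℝ} (hr : 1 ≤ r)
    (hrs : r ≤ s) :
    Real.log s * (ValueDistribution.characteristic h ⊤ r -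
        ValueDistribution.characteristic h ⊤ 1) ≤
      Real.log r * (ValueDistribution.characteristic h ⊤ s -
        ValueDistribution.characteristic h ⊤ 1) := by
  obtain ⟨c, hc⟩ := ValueDistribution.characteristic_top_eq_circleAverage_add_const hh
  rw [hc r (by linarith), hc s (by linarith), hc 1 one_ne_zero, add_sub_add_right_eq_sub,
    add_sub_add_right_eq_sub]
  have hint : ∀ R : ℝ, CircleIntegrable (fun a : ℂ => ValueDistribution.logCounting h a R) 0 1 :=
    fun R => ValueDistribution.circleIntegrable_logCounting hh
  have hsub : ∀ x y k : ℝ, k * (Real.circleAverage (fun a : ℂ => ValueDistribution.logCounting h a x) 0 1 -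
      Real.circleAverage (fun a : ℂ => ValueDistribution.logCounting h a y) 0 1) =
      Real.circleAverage (fun a : ℂ => k * (ValueDistribution.logCounting h a x -
        ValueDistribution.logCounting h a y)) 0 1 := by
    intro x y k
    have h1 := Real.circleAverage_sub (hint x) (hint y)
    rw [← h1]
    exact (Real.circleAverage_fun_smul (a := k) (f := fun a : ℂ =>
      ValueDistribution.logCounting h a x - ValueDistribution.logCounting h a y)
      (c := 0) (R := 1)).symm
  rw [hsub, hsub]
  apply Real.circleAverage_mono
  · exact ((hint r).sub (hint 1)).const_mul _
  · exact ((hint s).sub (hint 1)).const_mul _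
  · intro a _
    rw [ValueDistribution.logCounting_coe]
    exact logCounting_convexity (posPart_nonneg _) hr hrs

/-- A nonnegative convex function of `log r` is either `O(log r)` or grows faster than `log r`. -/
theorem log_isLittleO_or_le_of_convexity {T : ℝ → ℝ} (hT0 : ∀ r, 1 ≤ r → 0 ≤ T r)
    (hconv : ∀ r s, 1 ≤ r → r ≤ s → Real.log s * (T r - T 1) ≤ Real.log r * (T s - T 1)) :
    Real.log =o[atTop] T ∨ ∃ C, 0 ≤ C ∧ ∀ r, 1 ≤ r → T r ≤ C + C * Real.log r := by
  by_cases hlo : Real.log =o[atTop] T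
  · exact Or.inl hlo
  right
  rw [isLittleO_iff] at hlo
  push Not at hlo
  obtain ⟨c, hc, hfreq⟩ := hlo
  have hT1 := hT0 1 le_rfl
  refine ⟨T 1 + c⁻¹, by positivity, fun r hr => ?_⟩
  -- Beyond any `r` there is an `s` with `T s` at most `c⁻¹ log s`; convexity carries this bound
  -- back to `r`.
  obtain ⟨s, hs, hrs, hs2⟩ := (hfreq.and_eventually ((eventually_ge_atTop r).and
    (eventually_ge_atTop 2))).exists
  have hlogs : 0 < Real.log s := Real.log_pos (by linarith)
  have hlogr : 0 ≤ Real.log r := Real.log_nonneg hr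
  rw [Real.norm_of_nonneg (hT0 s (by linarith)), Real.norm_of_nonneg hlogs.le] at hs
  have h1 := hconv r s hr hrs
  have h2 : T s ≤ c⁻¹ * Real.log s := by
    rw [inv_mul_eq_div, le_div_iff₀ hc]
    linarith
  have h3 : Real.log s * (T r - T 1) ≤ Real.log s * (c⁻¹ * Real.log r) := by
    refine h1.trans ?_
    have : T s - T 1 ≤ c⁻¹ * Real.log s := by linarith
    calc Real.log r * (T s - T 1) ≤ Real.log r * (c⁻¹ * Real.log s) :=
          mul_le_mul_of_nonneg_left this hlogr
      _ = _ := by ring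
  have h4 := le_of_mul_le_mul_left h3 hlogs
  have h5 : 0 ≤ T 1 * Real.log r := mul_nonneg hT1 hlogr
  have h6 : 0 ≤ c⁻¹ := by positivity
  linarith

end HoloCurve
end

noncomputable section

namespace HoloCurve

/-! ### Asymptotic form of the lemma on the logarithmic derivative -/

/-- With radii `2r` and `4r`, every power of `log r` is divided by a power of `r`. -/
theorem logDerivBound_le_of_log_growth (i : ℕ) {C : ℝ} (hC : 0 ≤ C) :
    ∃ M : ℝ, ∀ r, 1 ≤ r → logDerivBound i r (2 * r) (4 * r) (C + C * Real.log (4 * r)) ≤ M := by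
  have hsin := sinAverage_nonneg
  have hlog2 : 0 < Real.log 2 := Real.log_pos one_lt_two
  set K := 5 * C + C * Real.log 4 with hK
  have hlog4 : 0 ≤ Real.log 4 := Real.log_nonneg (by norm_num)
  have hlog8 : 0 ≤ Real.log 8 := Real.log_nonneg (by norm_num)
  have hK0 : 0 ≤ K := by positivity
  refine ⟨Real.log (i.factorial * Real.exp 1 * 4 ^ i) + 2 * i * Real.log (1 +
    (K / Real.log 2 * sinAverage + Real.sqrt (4 * (K + (Real.log 8 + 4) * (K / Real.log 2)) + 1))),
    fun r hr => ?_⟩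
  have hr0 : 0 < r := by linarith
  -- Logarithms are absorbed by `w = r ^ (1/4)`: even two factors `w` stay below `√r`.
  set w := Real.sqrt (Real.sqrt r) with hw
  have hw1 : 1 ≤ w := Real.one_le_sqrt.mpr (Real.one_le_sqrt.mpr hr)
  have hw2 : w ^ 2 = Real.sqrt r := Real.sq_sqrt (Real.sqrt_nonneg _)
  have hw4 : w ^ 4 = r := by
    rw [show w ^ 4 = (w ^ 2) ^ 2 by ring, hw2, Real.sq_sqrt hr0.le]
  have hlogr : Real.log r ≤ 4 * w := by
    rw [← hw4, Real.log_pow]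
    have := Real.log_le_sub_one_of_pos (by linarith : 0 < w)
    push_cast
    linarith
  have hlogr0 : 0 ≤ Real.log r := Real.log_nonneg hr
  have hτ : C + C * Real.log (4 * r) ≤ K * w := by
    rw [Real.log_mul (by norm_num) hr0.ne', hK]
    have h1 : C * Real.log r ≤ C * (4 * w) := by gcongr
    have h2 : C ≤ C * w := le_mul_of_one_le_right hC hw1
    have h3 : C * Real.log 4 ≤ C * Real.log 4 * w := le_mul_of_one_le_right (by positivity) hw1
    linarith
  have hτ0 : 0 ≤ C + C * Real.log (4 * r) := by
    have := Real.log_nonneg (by linarith : 1 ≤ 4 * r)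
    positivity
  have hl8 : Real.log (4 * (2 * r)) ≤ (Real.log 8 + 4) * w := by
    rw [← mul_assoc, Real.log_mul (by norm_num) hr0.ne']
    norm_num
    have : Real.log 8 ≤ Real.log 8 * w := le_mul_of_one_le_right hlog8 hw1
    linarith
  have hl80 : 0 ≤ Real.log (4 * (2 * r)) := Real.log_nonneg (by linarith)
  have hdiv : 4 * r / (2 * r) = 2 := by field_simp; norm_num
  have hsub : 2 * r - r = r := by ring
  unfold logDerivBound
  rw [hdiv, hsub]
  set τ := C + C * Real.log (4 * r) with hτdef
  have hA : τ / Real.log 2 * (sinAverage * (Real.sqrt r)⁻¹) ≤ K / Real.log 2 * sinAverage := by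
    have h1 : τ * (Real.sqrt r)⁻¹ ≤ K := by
      rw [← div_eq_mul_inv, div_le_iff₀ (by positivity), ← hw2]
      nlinarith
    calc τ / Real.log 2 * (sinAverage * (Real.sqrt r)⁻¹)
        = τ * (Real.sqrt r)⁻¹ * (sinAverage / Real.log 2) := by ring
      _ ≤ K * (sinAverage / Real.log 2) := by gcongr
      _ = _ := by ring
  have hB : 2 * (2 * r) * (τ + Real.log (4 * (2 * r)) * (τ / Real.log 2)) / r ^ 2 + 1 / r ≤
      4 * (K + (Real.log 8 + 4) * (K / Real.log 2)) + 1 := by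
    have h1 : 1 / r ≤ 1 := by rw [div_le_one hr0]; exact hr
    have h2 : τ + Real.log (4 * (2 * r)) * (τ / Real.log 2) ≤
        (K + (Real.log 8 + 4) * (K / Real.log 2)) * r := by
      have e1 : τ ≤ K * r := by
        refine hτ.trans (mul_le_mul_of_nonneg_left ?_ hK0)
        rw [← hw4]
        exact le_self_pow₀ hw1 (by norm_num)
      have e2 : Real.log (4 * (2 * r)) * (τ / Real.log 2) ≤
          (Real.log 8 + 4) * w * (K * w / Real.log 2) := by gcongr
      have e3 : w * w ≤ r := by
        rw [← hw4, ← sq]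
        exact pow_le_pow_right₀ hw1 (by norm_num)
      have e4 : (Real.log 8 + 4) * w * (K * w / Real.log 2) ≤
          (Real.log 8 + 4) * (K / Real.log 2) * r := by
        calc (Real.log 8 + 4) * w * (K * w / Real.log 2)
            = (Real.log 8 + 4) * (K / Real.log 2) * (w * w) := by ring
          _ ≤ _ := by gcongr
      linarith
    have h3 : 2 * (2 * r) * (τ + Real.log (4 * (2 * r)) * (τ / Real.log 2)) / r ^ 2 ≤
        4 * (K + (Real.log 8 + 4) * (K / Real.log 2)) := by
      rw [div_le_iff₀ (by positivity)]
      calc _ ≤ 2 * (2 * r) * ((K + (Real.log 8 + 4) * (K / Real.log 2)) * r) := by gcongr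
        _ = _ := by ring
    linarith
  gcongr

/-- At these radii `log (R' / R) ≥ 1 / (4rT)` and `R - r = 1 / (2T)`, so the argument of the outer
logarithm is at most `K r³ T⁴`. -/
theorem logDerivBound_le_of_borel (i : ℕ) {C : ℝ} (hC : 0 ≤ C) :
    ∃ M : ℝ, 0 ≤ M ∧ ∀ r T, 1 ≤ r → 1 ≤ T →
      logDerivBound i r (r + 1 / (2 * T)) (r + 1 / T) (C * T) ≤
        M * (1 + Real.log r + Real.log T) := by
  have hsin := sinAverage_nonneg
  set K := 5 + 4 * C * sinAverage + 16 * C + 512 * C with hK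
  have hK1 : 1 ≤ K := by rw [hK]; nlinarith [mul_nonneg hC hsin]
  have hlogK : 0 ≤ Real.log K := Real.log_nonneg hK1
  set k := Real.log (i.factorial * Real.exp 1 * 4 ^ i) with hk
  refine ⟨|k| + 2 * i * (Real.log K + 4), by positivity, fun r T hr hT => ?_⟩
  have hr0 : 0 < r := by linarith
  have hT0 : 0 < T := by linarith
  have hlogr : 0 ≤ Real.log r := Real.log_nonneg hr
  have hlogT : 0 ≤ Real.log T := Real.log_nonneg hT
  set R := r + 1 / (2 * T) with hR
  set R' := r + 1 / T with hR'
  have hinvT : 1 / T ≤ 1 := by rw [div_le_one hT0]; exact hT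
  have hinv2 : 1 / (2 * T) = 1 / T / 2 := by field_simp
  have hinvT0 : 0 < 1 / T := by positivity
  have hRle : R ≤ 2 * r := by rw [hR, hinv2]; linarith
  have hR'le : R' ≤ 2 * r := by linarith
  have hRr : R - r = 1 / (2 * T) := by rw [hR]; ring
  have hR0 : 0 < R := by rw [hR]; positivity
  have hR'0 : 0 < R' := by rw [hR']; positivity
  have hR1 : 1 ≤ R := by rw [hR, hinv2]; linarith
  have hlog : 1 / (4 * r * T) ≤ Real.log (R' / R) := by
    have h1 := Real.one_sub_inv_le_log_of_pos (div_pos hR'0 hR0)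
    refine le_trans ?_ h1
    rw [inv_div]
    have h2 : 1 - R / R' = (1 / T / 2) / R' := by
      rw [eq_div_iff hR'0.ne', sub_mul, div_mul_cancel₀ _ hR'0.ne', hR, hR', hinv2]
      ring
    rw [h2, div_div, div_div]
    apply one_div_le_one_div_of_le (by positivity)
    nlinarith
  have hlog0 : 0 < 1 / (4 * r * T) := by positivity
  have hN : C * T / Real.log (R' / R) ≤ 4 * C * r * T ^ 2 := by
    rw [div_le_iff₀ (hlog0.trans_le hlog)]
    calc C * T = 4 * C * r * T ^ 2 * (1 / (4 * r * T)) := by field_simp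
      _ ≤ _ := by gcongr
  have hl4 : Real.log (4 * R) ≤ 8 * r := by
    refine (Real.log_le_sub_one_of_pos (by positivity)).trans ?_
    linarith
  have hl40 : 0 ≤ Real.log (4 * R) := Real.log_nonneg (by linarith)
  have hN0 : 0 ≤ C * T / Real.log (R' / R) := by
    have := hlog0.trans_le hlog
    positivity
  set P := r ^ 3 * T ^ 4 with hP
  have hP1 : 1 ≤ P := one_le_mul_of_one_le_of_one_le (one_le_pow₀ hr) (one_le_pow₀ hT)
  have hrT : ∀ a b : ℕ, a ≤ 3 → b ≤ 4 → r ^ a * T ^ b ≤ P := by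
    intro a b ha hb
    rw [hP]
    gcongr
  have hA : C * T / Real.log (R' / R) * (sinAverage * (Real.sqrt r)⁻¹) ≤ 4 * C * sinAverage * P := by
    have h1 : (Real.sqrt r)⁻¹ ≤ 1 := inv_le_one_of_one_le₀ (Real.one_le_sqrt.mpr hr)
    have h2 := hrT 1 2 (by norm_num) (by norm_num)
    calc C * T / Real.log (R' / R) * (sinAverage * (Real.sqrt r)⁻¹)
        ≤ 4 * C * r * T ^ 2 * (sinAverage * 1) := by gcongr
      _ = 4 * C * sinAverage * (r ^ 1 * T ^ 2) := by ring
      _ ≤ _ := by gcongr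
  have hB : 2 * R * (C * T + Real.log (4 * R) * (C * T / Real.log (R' / R))) / (R - r) ^ 2 +
      1 / (R - r) ≤ (16 * C + 512 * C + 2) * P := by
    rw [hRr]
    have h1 : C * T + Real.log (4 * R) * (C * T / Real.log (R' / R)) ≤
        C * T + 8 * r * (4 * C * r * T ^ 2) := by gcongr
    have h0 : 0 ≤ C * T + 8 * r * (4 * C * r * T ^ 2) := by positivity
    have h2 : 2 * R * (C * T + Real.log (4 * R) * (C * T / Real.log (R' / R))) /
        (1 / (2 * T)) ^ 2 ≤ 2 * (2 * r) * (C * T + 8 * r * (4 * C * r * T ^ 2)) /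
        (1 / (2 * T)) ^ 2 := by
      gcongr
    have h3 : 2 * (2 * r) * (C * T + 8 * r * (4 * C * r * T ^ 2)) / (1 / (2 * T)) ^ 2 =
        16 * C * (r ^ 1 * T ^ 3) + 512 * C * (r ^ 3 * T ^ 4) := by
      field_simp
      ring
    have h4 : 1 / (1 / (2 * T)) = 2 * (r ^ 0 * T ^ 1) := by
      field_simp
    have h5 : 16 * C * (r ^ 1 * T ^ 3) ≤ 16 * C * P := by
      gcongr
      exact hrT 1 3 (by norm_num) (by norm_num)
    have h6 : 512 * C * (r ^ 3 * T ^ 4) ≤ 512 * C * P := by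
      gcongr
    have h7 := hrT 0 1 (by norm_num) (by norm_num)
    rw [h4]
    linarith
  have hB0 : 0 ≤ 2 * R * (C * T + Real.log (4 * R) * (C * T / Real.log (R' / R))) / (R - r) ^ 2 +
      1 / (R - r) := by
    rw [hRr]
    positivity
  have hsqrt : Real.sqrt (2 * R * (C * T + Real.log (4 * R) * (C * T / Real.log (R' / R))) /
      (R - r) ^ 2 + 1 / (R - r)) ≤ 1 + (16 * C + 512 * C + 2) * P := by
    rw [Real.sqrt_le_left (by positivity)]
    nlinarith
  have hin : 1 + (C * T / Real.log (R' / R) * (sinAverage * (Real.sqrt r)⁻¹) +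
      Real.sqrt (2 * R * (C * T + Real.log (4 * R) * (C * T / Real.log (R' / R))) /
      (R - r) ^ 2 + 1 / (R - r))) ≤ K * P := by
    rw [hK]
    linarith
  unfold logDerivBound
  have hlogin : Real.log (1 + (C * T / Real.log (R' / R) * (sinAverage * (Real.sqrt r)⁻¹) +
      Real.sqrt (2 * R * (C * T + Real.log (4 * R) * (C * T / Real.log (R' / R))) /
      (R - r) ^ 2 + 1 / (R - r)))) ≤ Real.log K + 3 * Real.log r + 4 * Real.log T := by
    refine (Real.log_le_log (by positivity) hin).trans_eq ?_
    rw [Real.log_mul (by positivity) (by positivity), hP, Real.log_mul (by positivity)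
      (by positivity), Real.log_pow, Real.log_pow]
    push_cast
    ring
  have hlogin2 : Real.log K + 3 * Real.log r + 4 * Real.log T ≤
      (Real.log K + 4) * (1 + Real.log r + Real.log T) := by
    nlinarith [mul_nonneg hlogK hlogr, mul_nonneg hlogK hlogT]
  have hk1 : k ≤ |k| * (1 + Real.log r + Real.log T) :=
    (le_abs_self k).trans (le_mul_of_one_le_right (abs_nonneg k) (by linarith))
  rw [← hk, add_mul]
  refine add_le_add hk1 ?_
  rw [mul_assoc (2 * (i : ℝ))]
  exact mul_le_mul_of_nonneg_left (hlogin.trans hlogin2) (by positivity)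

/-- The lemma on the logarithmic derivative: the proximity functions of the logarithmic derivatives
of finitely many meromorphic functions are negligible with respect to any unbounded function
dominating their characteristics, outside a set of finite measure. -/
theorem exists_isLittleO_circleAverage_posLog_iteratedDeriv {ι : Type*} (A : Finset ι)
    (h : ι → ℂ → ℂ) (hh : ∀ a ∈ A, Meromorphic (h a))
    (hh0 : ∀ a ∈ A, ∀ z, meromorphicOrderAt (h a) z ≠ ⊤) {𝒯 : ℝ → ℝ} (h𝒯 : Tendsto 𝒯 atTop atTop)
    (hdom : (fun r => ∑ a ∈ A, ValueDistribution.characteristic (h a) ⊤ r) =O[atTop] 𝒯) :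
    ∃ E : Set ℝ, volume E < ⊤ ∧ ∀ a ∈ A, ∀ i : ℕ,
      (fun r => Real.circleAverage (fun z => Real.posLog ‖iteratedDeriv i (h a) z / h a z‖) 0 r)
        =o[atTop ⊓ 𝓟 Eᶜ] 𝒯 := by
  classical
  set T : ℝ → ℝ := fun r => ∑ a ∈ A, ValueDistribution.characteristic (h a) ⊤ r with hT
  have hchar0 : ∀ a, ∀ r, 1 ≤ r → 0 ≤ ValueDistribution.characteristic (h a) ⊤ r := fun a r hr =>
    ValueDistribution.characteristic_nonneg hr
  have hT0 : ∀ r, 1 ≤ r → 0 ≤ T r := fun r hr => Finset.sum_nonneg fun a _ => hchar0 a r hr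
  have hTmono : ∀ r s, 1 ≤ r → r ≤ s → T r ≤ T s := by
    intro r s hr hrs
    apply Finset.sum_le_sum
    intro a ha
    exact ValueDistribution.characteristic_monotoneOn (hh a ha) (Set.mem_Ioi.mpr (by linarith))
      (Set.mem_Ioi.mpr (by linarith)) hrs
  have hTconv : ∀ r s, 1 ≤ r → r ≤ s →
      Real.log s * (T r - T 1) ≤ Real.log r * (T s - T 1) := by
    intro r s hr hrs
    simp only [hT]
    rw [← Finset.sum_sub_distrib, ← Finset.sum_sub_distrib, Finset.mul_sum, Finset.mul_sum]
    exact Finset.sum_le_sum fun a ha => characteristic_convexity (hh a ha) hr hrs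
  have hle : ∀ a ∈ A, ∀ r, 1 ≤ r → ValueDistribution.characteristic (h a) ⊤ r ≤ T r :=
    fun a ha r hr => Finset.single_le_sum
      (f := fun a => ValueDistribution.characteristic (h a) ⊤ r) (fun a _ => hchar0 a r hr) ha
  have havg0 : ∀ a (i : ℕ) r,
      0 ≤ Real.circleAverage (fun z => Real.posLog ‖iteratedDeriv i (h a) z / h a z‖) 0 r :=
    fun a i r => Real.circleAverage_nonneg_of_nonneg fun _ _ => Real.posLog_nonneg
  have hone : (fun _ : ℝ => (1 : ℝ)) =o[atTop] 𝒯 := by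
    rw [isLittleO_const_left]
    exact Or.inr (tendsto_norm_atTop_atTop.comp h𝒯)
  -- Borel's radii cost a term `log r`, acceptable only if `log r = o(T)`. Otherwise `T = O(log r)`,
  -- and the error is bounded with no exceptional set.
  rcases log_isLittleO_or_le_of_convexity hT0 hTconv with hlo | ⟨C, hC, hlog⟩
  · have hTtop : Tendsto T atTop atTop := by
      have h1 : Tendsto (fun r => ‖T r‖) atTop atTop := by
        refine tendsto_atTop_mono' atTop ?_ Real.tendsto_log_atTop
        filter_upwards [hlo.bound one_pos, eventually_ge_atTop 1] with r hr hr1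
        rw [one_mul] at hr
        exact (le_abs_self _).trans hr
      refine h1.congr' ?_
      filter_upwards [eventually_ge_atTop 1] with r hr
      exact Real.norm_of_nonneg (hT0 r hr)
    -- Borel's lemma requires a function bounded below by `1`.
    set T₁ : ℝ → ℝ := fun r => T r + 1 with hT₁
    have hT₁1 : ∀ r, 1 ≤ r → 1 ≤ T₁ r := fun r hr => by
      simp only [hT₁]
      linarith [hT0 r hr]
    set E := {r | 1 ≤ r ∧ 2 * T₁ r ≤ T₁ (r + 1 / T₁ r)} with hE
    have hEvol : volume E < ⊤ := volume_setOf_two_mul_le_lt_top (T := T₁) (r₀ := 1)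
      (fun r hr s _ hrs => add_le_add_left (hTmono r s hr hrs) 1) hT₁1
    refine ⟨E, hEvol, fun a ha i => ?_⟩
    obtain ⟨c, hc⟩ := exists_circleAverage_posLog_iteratedDeriv_le (hh a ha) (hh0 a ha)
    obtain ⟨M, hM0, hM⟩ := logDerivBound_le_of_borel i (C := 4 + |c|) (by positivity)
    have hbound : ∀ r, 1 ≤ r → r ∉ E →
        Real.circleAverage (fun z => Real.posLog ‖iteratedDeriv i (h a) z / h a z‖) 0 r ≤
          M * (1 + Real.log r + Real.log (T₁ r)) := by
      intro r hr hrE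
      have h1 := hT₁1 r hr
      have hlt : T₁ (r + 1 / T₁ r) < 2 * T₁ r := by
        by_contra! hcon
        exact hrE ⟨hr, hcon⟩
      have hinv : 0 < 1 / T₁ r := by positivity
      have hinv2 : 1 / (2 * T₁ r) = 1 / T₁ r / 2 := by field_simp
      have hlt' : T (r + 1 / T₁ r) ≤ 2 * T₁ r := by
        have : T₁ (r + 1 / T₁ r) = T (r + 1 / T₁ r) + 1 := rfl
        linarith
      have hcle : c ≤ |c| * T₁ r := (le_abs_self c).trans (le_mul_of_one_le_right (abs_nonneg c) h1)
      refine (hc i r (r + 1 / (2 * T₁ r)) (r + 1 / T₁ r) ((4 + |c|) * T₁ r) hr ?_ ?_ ?_ ?_).trans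
        (hM r (T₁ r) hr h1)
      · rw [hinv2]; linarith
      · rw [hinv2]; linarith
      · have e1 := hle a ha (r + 1 / (2 * T₁ r)) (by rw [hinv2]; linarith)
        have e2 := hTmono (r + 1 / (2 * T₁ r)) (r + 1 / T₁ r) (by rw [hinv2]; linarith)
          (by rw [hinv2]; linarith)
        linarith
      · have e1 := hle a ha (r + 1 / T₁ r) (by linarith)
        linarith
    have hlittle : (fun r => M * (1 + Real.log r + Real.log (T₁ r))) =o[atTop] 𝒯 := by
      apply IsLittleO.const_mul_left
      refine (hone.add (hlo.trans_isBigO hdom)).add ?_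
      have hT₁top : Tendsto T₁ atTop atTop := tendsto_atTop_add_const_right _ 1 hTtop
      have e1 : (fun r => Real.log (T₁ r)) =o[atTop] T₁ :=
        Real.isLittleO_log_id_atTop.comp_tendsto hT₁top
      exact e1.trans_isBigO (hdom.add hone.isBigO)
    refine IsBigO.trans_isLittleO (IsBigO.of_bound 1 ?_) (hlittle.mono inf_le_left)
    rw [eventually_inf_principal]
    filter_upwards [eventually_ge_atTop 1] with r hr hrE
    rw [Real.norm_of_nonneg (havg0 a i r), one_mul]
    exact (hbound r hr hrE).trans (le_abs_self _)
  · refine ⟨∅, by simp, fun a ha i => ?_⟩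
    obtain ⟨c, hc⟩ := exists_circleAverage_posLog_iteratedDeriv_le (hh a ha) (hh0 a ha)
    obtain ⟨M, hM⟩ := logDerivBound_le_of_log_growth i (C := 2 * C + |c|) (by positivity)
    have hbound : ∀ r, 1 ≤ r →
        Real.circleAverage (fun z => Real.posLog ‖iteratedDeriv i (h a) z / h a z‖) 0 r ≤ M := by
      intro r hr
      refine (hc i r (2 * r) (4 * r) _ hr (by linarith) (by linarith) ?_ ?_).trans (hM r hr)
      · have e1 := hle a ha (2 * r) (by linarith)
        have e2 := hlog (2 * r) (by linarith)
        have e3 : Real.log (2 * r) ≤ Real.log (4 * r) :=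
          Real.log_le_log (by linarith) (by linarith)
        have e4 : 0 ≤ Real.log (4 * r) := Real.log_nonneg (by linarith)
        have e5 := mul_le_mul_of_nonneg_left e3 hC
        have e6 := mul_nonneg (abs_nonneg c) e4
        have e7 := le_abs_self c
        nlinarith
      · have e1 := hle a ha (4 * r) (by linarith)
        have e2 := hlog (4 * r) (by linarith)
        have e4 : 0 ≤ Real.log (4 * r) := Real.log_nonneg (by linarith)
        have e6 := mul_nonneg (abs_nonneg c) e4
        have e7 := le_abs_self c
        nlinarith
    refine IsBigO.trans_isLittleO (IsBigO.of_bound |M| ?_) (hone.mono inf_le_left)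
    rw [eventually_inf_principal]
    filter_upwards [eventually_ge_atTop 1] with r hr _
    rw [Real.norm_of_nonneg (havg0 a i r), norm_one, mul_one]
    exact (hbound r hr).trans (le_abs_self _)

end HoloCurve
end

noncomputable section

namespace HoloCurve

/-! ### Nevanlinna theory of entire functions -/

section Entire

variable {g : ℂ → ℂ}

theorem logCounting_top_of_differentiable (hg : Differentiable ℂ g) :
    ValueDistribution.logCounting g ⊤ = 0 := by
  have h : AnalyticOnNhd ℂ g Set.univ := fun z _ => hg.analyticAt z
  rw [ValueDistribution.logCounting_top, negPart_eq_zero.mpr (MeromorphicOn.AnalyticOnNhd.divisor_nonneg h), map_zero]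

theorem circleAverage_log_norm_of_differentiable (hg : Differentiable ℂ g) {r : ℝ} (hr : r ≠ 0) :
    Real.circleAverage (fun z => Real.log ‖g z‖) 0 r =
      ValueDistribution.logCounting g 0 r + Real.log ‖meromorphicTrailingCoeffAt g 0‖ := by
  have h := ValueDistribution.logCounting_zero_sub_logCounting_top_eq_circleAverage_sub_const
    (f := g) (fun z => (hg.analyticAt z).meromorphicAt) hr
  rw [logCounting_top_of_differentiable hg, sub_zero] at h
  linarith

theorem meromorphicOrderAt_ne_top_of_differentiable (hg : Differentiable ℂ g)
    (hg0 : ∃ z, g z ≠ 0) (z : ℂ) : meromorphicOrderAt g z ≠ ⊤ := by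
  intro h
  obtain ⟨w, hw⟩ := hg0
  rw [meromorphicOrderAt_eq_top_iff] at h
  exact hw (congrFun (AnalyticOnNhd.eq_of_frequently_eq (f := g) (g := fun _ => 0)
    (fun z _ => hg.analyticAt z) (fun z _ => analyticAt_const) h.frequently) w)

theorem eventually_codiscreteWithin_ne_zero (hg : Differentiable ℂ g) (hg0 : ∃ z, g z ≠ 0)
    (U : Set ℂ) : ∀ᶠ z in codiscreteWithin U, g z ≠ 0 := by
  obtain ⟨w, hw⟩ := hg0
  have h := AnalyticOnNhd.preimage_zero_mem_codiscreteWithin (U := Set.univ) (f := g)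
    (fun z _ => hg.analyticAt z) hw (Set.mem_univ _) isConnected_univ
  filter_upwards [codiscreteWithin_mono (Set.subset_univ U) h] with z hz using hz

end Entire

variable {n : ℕ} {f : ℂ → ProjSpace n} {F : ℂ → HomCoord n}

theorem IsReducedRepresentation.differentiable_inner (hF : IsReducedRepresentation f F)
    (v : HomCoord n) : Differentiable ℂ fun z => inner ℂ v (F z) :=
  (innerSL ℂ v).differentiable.comp hF.differentiable

theorem IsReducedRepresentation.circleIntegrable_log_norm (hF : IsReducedRepresentation f F)
    (r : ℝ) : CircleIntegrable (fun z => Real.log ‖F z‖) 0 r :=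
  hF.circleIntegrable_log_norm_comp (ContinuousLinearMap.id ℂ _) r

theorem LinearlyNondegenerate.exists_inner_ne_zero (hnd : LinearlyNondegenerate F)
    {v : HomCoord n} (hv : v ≠ 0) : ∃ z, inner ℂ v (F z) ≠ 0 := by
  by_contra! h
  apply hv
  have := hnd.eq_zero_of_forall (c := fun j => (starRingEnd ℂ) (v j)) fun z => by
    rw [← h z, PiLp.inner_apply]
    simp [mul_comm]
  ext j
  simpa using congrFun this j

/-- The characteristic of a quotient of two linear forms is dominated by that of the curve. -/
theorem exists_characteristic_div_le (hF : IsReducedRepresentation f F)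
    (hnd : LinearlyNondegenerate F) {v w : HomCoord n} (hv : ‖v‖ = 1) (hw : ‖w‖ = 1) :
    ∃ C, ∀ r, 1 ≤ r →
      ValueDistribution.characteristic (fun z => inner ℂ v (F z) / inner ℂ w (F z)) ⊤ r ≤
        characteristic F r + C := by
  set g : ℂ → ℂ := fun z => inner ℂ v (F z) with hgdef
  set φ : ℂ → ℂ := fun z => inner ℂ w (F z) with hφdef
  have hg : Differentiable ℂ g := hF.differentiable_inner v
  have hφ : Differentiable ℂ φ := hF.differentiable_inner w
  have hg0 : ∃ z, g z ≠ 0 := hnd.exists_inner_ne_zero (by rintro rfl; simp at hv)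
  have hφ0 : ∃ z, φ z ≠ 0 := hnd.exists_inner_ne_zero (by rintro rfl; simp at hw)
  have hgm : Meromorphic g := fun z => (hg.analyticAt z).meromorphicAt
  have hφm : Meromorphic φ := fun z => (hφ.analyticAt z).meromorphicAt
  refine ⟨Real.log ‖F 0‖ - Real.log ‖meromorphicTrailingCoeffAt φ 0‖, fun r hr => ?_⟩
  have hr0 : r ≠ 0 := by linarith
  have heq : (fun z => g z / φ z) = g * φ⁻¹ := by
    funext z
    simp [div_eq_mul_inv]
  have hcount : ValueDistribution.logCounting (fun z => g z / φ z) ⊤ r ≤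
      ValueDistribution.logCounting φ 0 r := by
    rw [heq]
    refine (ValueDistribution.logCounting_mul_top_le hr hgm
      (meromorphicOrderAt_ne_top_of_differentiable hg hg0) hφm.inv fun z => ?_).trans ?_
    · rw [meromorphicOrderAt_inv]
      simpa using meromorphicOrderAt_ne_top_of_differentiable hφ hφ0 z
    · rw [logCounting_top_of_differentiable hg, zero_add, ValueDistribution.logCounting_inv]
  have hintφ : CircleIntegrable (fun z => Real.log ‖φ z‖) 0 r :=
    hF.circleIntegrable_log_norm_comp (innerSL ℂ w) r
  -- Both forms are at most `‖F‖` in modulus, so `log⁺ ‖g/φ‖ ≤ log ‖F‖ - log ‖φ‖`. By Jensen the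
  -- average of `log ‖φ‖` cancels the counting function of the poles, up to a constant.
  have hprox : ValueDistribution.proximity (fun z => g z / φ z) ⊤ r ≤
      Real.circleAverage (fun z => Real.log ‖F z‖) 0 r -
        Real.circleAverage (fun z => Real.log ‖φ z‖) 0 r := by
    rw [ValueDistribution.proximity_top,
      ← Real.circleAverage_sub (hF.circleIntegrable_log_norm r) hintφ]
    refine circleAverage_mono_codiscreteWithin hr0 ?_
      ((hF.circleIntegrable_log_norm r).sub hintφ) ?_
    · apply MeromorphicOn.circleIntegrable_posLog_norm
      intro z _
      exact (hgm.div hφm) z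
    · filter_upwards [eventually_codiscreteWithin_ne_zero hφ hφ0 _] with z hz
      have hFz : 0 < ‖F z‖ := norm_pos_iff.mpr (hF.no_common_zero z)
      have hφz : 0 < ‖φ z‖ := norm_pos_iff.mpr hz
      have hgle : ‖g z‖ ≤ ‖F z‖ := by simpa [hv] using norm_inner_le_norm (𝕜 := ℂ) v (F z)
      have hφle : ‖φ z‖ ≤ ‖F z‖ := by simpa [hw] using norm_inner_le_norm (𝕜 := ℂ) w (F z)
      simp only [Pi.sub_apply]
      rw [← Real.log_div hFz.ne' hφz.ne', norm_div]
      have h1 : 1 ≤ ‖F z‖ / ‖φ z‖ := (one_le_div hφz).mpr hφle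
      rw [← Real.posLog_eq_log (by rwa [abs_of_nonneg (by positivity)])]
      apply Real.posLog_le_posLog (by positivity)
      gcongr
  have hJ := circleAverage_log_norm_of_differentiable hφ hr0
  simp only [ValueDistribution.characteristic, Pi.add_apply, characteristic]
  linarith

/-- A non-degenerate curve in a projective space of positive dimension has an unbounded
characteristic. -/
theorem tendsto_characteristic (hF : IsReducedRepresentation f F)
    (hnd : LinearlyNondegenerate F) (hn : 1 ≤ n) :
    Tendsto (characteristic F) atTop atTop := by
  -- As `n ≥ 1`, some nonzero linear form vanishes at `F 0`. Its counting function is at least `log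
  -- r`, and Jensen's formula gives `T ≥ log r - C`.
  obtain ⟨v, hv, hv0⟩ : ∃ v : HomCoord n, v ≠ 0 ∧ inner ℂ v (F 0) = 0 := by
    have hne : (Submodule.span ℂ {F 0})ᗮ ≠ ⊥ := by
      intro h
      have h1 := Submodule.finrank_add_finrank_orthogonal (Submodule.span ℂ {F 0})
      rw [h, finrank_bot, finrank_euclideanSpace, Fintype.card_fin] at h1
      have := finrank_span_singleton (K := ℂ) (hF.no_common_zero 0)
      omega
    obtain ⟨v, hv, hv0⟩ := Submodule.exists_mem_ne_zero_of_ne_bot hne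
    refine ⟨v, hv0, ?_⟩
    rw [Submodule.mem_orthogonal_singleton_iff_inner_left] at hv
    exact hv
  set g : ℂ → ℂ := fun z => inner ℂ v (F z) with hgdef
  have hg : Differentiable ℂ g := hF.differentiable_inner v
  have hg0 : ∃ z, g z ≠ 0 := hnd.exists_inner_ne_zero hv
  have hga : AnalyticOnNhd ℂ g Set.univ := fun z _ => hg.analyticAt z
  set D := MeromorphicOn.divisor g Set.univ with hD
  have hD0 : 0 ≤ D := MeromorphicOn.AnalyticOnNhd.divisor_nonneg hga
  have hD1 : (1 : ℤ) ≤ D 0 := by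
    rw [hD, MeromorphicOn.divisor_apply hga.meromorphicOn (Set.mem_univ _)]
    have h1 : 0 < meromorphicOrderAt g 0 := by
      rw [← tendsto_zero_iff_meromorphicOrderAt_pos (hg.analyticAt 0).meromorphicAt]
      have h1 := hg.continuous.tendsto 0
      rw [show g 0 = 0 from hv0] at h1
      exact h1.mono_left nhdsWithin_le_nhds
    lift meromorphicOrderAt g 0 to ℤ using
      meromorphicOrderAt_ne_top_of_differentiable hg hg0 0 with k
    exact Order.one_le_iff_pos.mpr (by simpa using h1)
  set C : ℝ := Real.log ‖v‖ + Real.log ‖F 0‖ - Real.log ‖meromorphicTrailingCoeffAt g 0‖ with hC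
  have hlow : ∀ r, 2 ≤ r → Real.log r - C ≤ characteristic F r := by
    intro r hr
    have hr0 : r ≠ 0 := by linarith
    have h1 : Real.log r ≤ ValueDistribution.logCounting g 0 r := by
      have := sum_mul_log_div_le_logCounting hD0 (R := 1) (R' := r) le_rfl (by linarith) {0}
        (by simp)
      rw [ValueDistribution.logCounting_zero, posPart_eq_self.mpr hD0]
      refine le_trans ?_ this
      have hlog : 0 ≤ Real.log r := Real.log_nonneg (by linarith)
      have h2 : (1 : ℝ) ≤ D 0 := by exact_mod_cast hD1
      simp only [Finset.sum_singleton, div_one]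
      nlinarith
    have hint : CircleIntegrable (fun z => Real.log ‖g z‖) 0 r :=
      hF.circleIntegrable_log_norm_comp (innerSL ℂ v) r
    have h2 : Real.circleAverage (fun z => Real.log ‖g z‖) 0 r ≤
        Real.circleAverage ((fun z => Real.log ‖F z‖) + fun _ => Real.log ‖v‖) 0 r := by
      refine circleAverage_mono_codiscreteWithin hr0 hint
        ((hF.circleIntegrable_log_norm r).add (circleIntegrable_const _ _ _)) ?_
      filter_upwards [eventually_codiscreteWithin_ne_zero hg hg0 _] with z hz
      simp only [Pi.add_apply]
      rw [add_comm, ← Real.log_mul (norm_ne_zero_iff.mpr hv)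
        (norm_ne_zero_iff.mpr (hF.no_common_zero z))]
      exact Real.log_le_log (norm_pos_iff.mpr hz) (norm_inner_le_norm _ _)
    rw [Real.circleAverage_add (hF.circleIntegrable_log_norm r) (circleIntegrable_const _ _ _),
      Real.circleAverage_const] at h2
    have h3 := circleAverage_log_norm_of_differentiable hg hr0
    simp only [characteristic]
    linarith
  refine tendsto_atTop_mono' atTop (f₁ := fun r => Real.log r - C) ?_ ?_
  · filter_upwards [eventually_ge_atTop 2] with r hr using hlow r hr
  · exact tendsto_atTop_add_const_right _ _ Real.tendsto_log_atTop

/-- The second main theorem with its error term expressed by logarithmic derivatives. -/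
theorem exists_sum_flatProximity_add_ramificationCounting_le (hF : IsReducedRepresentation f F)
    (hnd : LinearlyNondegenerate F) {A : Finset (Submodule ℂ (HomCoord n))}
    {ν : Submodule ℂ (HomCoord n) → HomCoord n} (hν : ∀ a ∈ A, a = (Submodule.span ℂ {ν a})ᗮ)
    (hν1 : ∀ a ∈ A, ‖ν a‖ = 1) (hA : IsComplete A) {w : HomCoord n} (hw : w ≠ 0) :
    ∃ C : ℝ, ∀ r, r ≠ 0 →
      ∑ k ∈ Finset.Icc 1 n, flatProximity A k f r + ramificationCounting F r ≤
        (n + 1) * characteristic F r + C + (n + 1) * ∑ a ∈ A, ∑ i ∈ Finset.range (n + 1),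
          Real.circleAverage (fun z => Real.posLog
            ‖iteratedDeriv i (fun z => inner ℂ (ν a) (F z) / inner ℂ w (F z)) z /
              (inner ℂ (ν a) (F z) / inner ℂ w (F z))‖) 0 r := by
  classical
  set φ : ℂ → ℂ := fun z => inner ℂ w (F z) with hφdef
  set h : Submodule ℂ (HomCoord n) → ℂ → ℂ := fun a z => inner ℂ (ν a) (F z) / φ z with hh
  have hφ : Differentiable ℂ φ := hF.differentiable_inner w
  have hφ0 : ∃ z, φ z ≠ 0 := hnd.exists_inner_ne_zero hw
  have hW : Differentiable ℂ (wronskian F) := differentiable_wronskian hF.entire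
  have hW0 : ∃ z, wronskian F z ≠ 0 := exists_wronskian_ne_zero hF.entire hnd
  have hhm : ∀ a, Meromorphic (h a) := fun a z =>
    ((hF.differentiable_inner (ν a)).analyticAt z).meromorphicAt.div
      (hφ.analyticAt z).meromorphicAt
  set δ : (Fin (n + 1) → A) → ℝ := fun b => Real.log ‖(dualMatrix fun i => ν (b i)).det‖ with hδ
  -- The basis `b` varies with `z`; summing `|δ b|` over all finitely many `b` makes the constant
  -- uniform.
  set C₀ : ℝ := Real.log (n + 1).factorial + ∑ b, |δ b| with hC₀
  refine ⟨C₀ + (n + 1) * Real.log ‖F 0‖ -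
    Real.log ‖meromorphicTrailingCoeffAt (wronskian F) 0‖, fun r hr => ?_⟩
  have hintF := hF.circleIntegrable_log_norm r
  have hintW : CircleIntegrable (fun z => Real.log ‖wronskian F z‖) 0 r :=
    MeromorphicOn.circleIntegrable_log_norm fun z _ => (hW.analyticAt z).meromorphicAt
  have hintk : ∀ k ∈ Finset.Icc 1 n,
      CircleIntegrable (fun z => Real.log (1 / flatDist A k (f z))) 0 r := fun k hk =>
    hF.circleIntegrable_log_flatDist A (Finset.mem_Icc.mp hk).2 r
  have hintl : ∀ a ∈ A, ∀ i ∈ Finset.range (n + 1),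
      CircleIntegrable (fun z => Real.posLog ‖iteratedDeriv i (h a) z / h a z‖) 0 r := by
    intro a _ i _
    apply MeromorphicOn.circleIntegrable_posLog_norm
    intro z _
    exact ((meromorphic_iteratedDeriv (hhm a) i).div (hhm a)) z
  have hintl' : ∀ a ∈ A, CircleIntegrable (fun z => ∑ i ∈ Finset.range (n + 1),
      Real.posLog ‖iteratedDeriv i (h a) z / h a z‖) 0 r := fun a ha =>
    CircleIntegrable.fun_sum _ (hintl a ha)
  have hintL : CircleIntegrable (logDerivSum A n h) 0 r := CircleIntegrable.fun_sum _ hintl'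
  have hintG : CircleIntegrable (fun z => ∑ k ∈ Finset.Icc 1 n,
      Real.log (1 / flatDist A k (f z))) 0 r := CircleIntegrable.fun_sum _ hintk
  have hint1 : CircleIntegrable (fun z => (n + 1 : ℝ) * Real.log ‖F z‖) 0 r := hintF.const_mul _
  have hint2 : CircleIntegrable (fun z => (n + 1 : ℝ) * logDerivSum A n h z) 0 r :=
    hintL.const_mul _
  have hkey : Real.circleAverage ((fun z => ∑ k ∈ Finset.Icc 1 n,
      Real.log (1 / flatDist A k (f z))) + fun z => Real.log ‖wronskian F z‖) 0 r ≤
      Real.circleAverage (((fun z => (n + 1 : ℝ) * Real.log ‖F z‖) + fun _ => C₀) +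
        fun z => (n + 1 : ℝ) * logDerivSum A n h z) 0 r := by
    refine circleAverage_mono_codiscreteWithin hr (hintG.add hintW)
      ((hint1.add (circleIntegrable_const _ _ _)).add hint2) ?_
    have hgen : ∀ᶠ z in codiscreteWithin (Metric.sphere (0 : ℂ) |r|),
        ∀ a ∈ A, inner ℂ (ν a) (F z) ≠ 0 := by
      rw [Finset.eventually_all]
      intro a ha
      refine eventually_codiscreteWithin_ne_zero (hF.differentiable_inner _)
        (hnd.exists_inner_ne_zero ?_) _
      intro h0
      simpa [h0] using hν1 a ha
    filter_upwards [hgen, eventually_codiscreteWithin_ne_zero hφ hφ0 _,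
      eventually_codiscreteWithin_ne_zero hW hW0 _] with z hz hφz hWz
    simp only [Pi.add_apply]
    have hFz : ‖F z‖ ≠ 0 := norm_ne_zero_iff.mpr (hF.no_common_zero z)
    obtain ⟨b, hb, hsum⟩ := exists_basis_sum_log_flatDist_le hν hν1 hA (F z)
      (hF.no_common_zero z) hz
    rw [← hF.eq_mk z] at hsum
    have hwr := log_wronskian_le hF.entire φ hφ b hb z hφz hWz hz
    have hsplit : ∑ i, Real.log (‖F z‖ / ‖inner ℂ (ν (b i)) (F z)‖) =
        (n + 1) * Real.log ‖F z‖ - ∑ i, Real.log ‖inner ℂ (ν (b i)) (F z)‖ := by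
      rw [Finset.sum_congr rfl fun i _ => Real.log_div hFz
        (norm_ne_zero_iff.mpr (hz _ (b i).2)), Finset.sum_sub_distrib]
      simp
    have hδb : -δ b ≤ ∑ b, |δ b| := (neg_le_abs _).trans
      (Finset.single_le_sum (f := fun b => |δ b|) (fun b _ => abs_nonneg _) (Finset.mem_univ b))
    linarith
  rw [Real.circleAverage_add hintG hintW,
    Real.circleAverage_add (hint1.add (circleIntegrable_const _ _ _)) hint2,
    Real.circleAverage_add hint1 (circleIntegrable_const _ _ _), Real.circleAverage_const,
    Real.circleAverage_fun_sum hintk, circleAverage_log_norm_of_differentiable hW hr] at hkey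
  have h1 : Real.circleAverage (fun z => (n + 1 : ℝ) * Real.log ‖F z‖) 0 r =
      (n + 1) * Real.circleAverage (fun z => Real.log ‖F z‖) 0 r :=
    Real.circleAverage_fun_smul (a := (n + 1 : ℝ))
  have h2 : Real.circleAverage (fun z => (n + 1 : ℝ) * logDerivSum A n h z) 0 r =
      (n + 1) * ∑ a ∈ A, ∑ i ∈ Finset.range (n + 1),
        Real.circleAverage (fun z => Real.posLog ‖iteratedDeriv i (h a) z / h a z‖) 0 r := by
    rw [show (fun z => (n + 1 : ℝ) * logDerivSum A n h z) =
      fun z => (n + 1 : ℝ) • logDerivSum A n h z from rfl, Real.circleAverage_fun_smul, smul_eq_mul]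
    congr 1
    unfold logDerivSum
    rw [Real.circleAverage_fun_sum hintl']
    exact Finset.sum_congr rfl fun a ha => Real.circleAverage_fun_sum (hintl a ha)
  rw [h1, h2] at hkey
  simp only [hh, hφdef] at hkey
  simp only [flatProximity, ramificationCounting, characteristic]
  linarith

end HoloCurve

end

/-! ### The second main theorem without general position -/

theorem theorem1 (n : ℕ) (f : ℂ → HoloCurve.ProjSpace n) (F : ℂ → HoloCurve.HomCoord n)
    (hF : HoloCurve.IsReducedRepresentation f F)
    (hnd : HoloCurve.LinearlyNondegenerate F)
    (A : Finset (Submodule ℂ (HoloCurve.HomCoord n)))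
    (hA : ∀ a ∈ A, IsCoatom a)
    (hcomplete : HoloCurve.IsComplete A) :
    (∀ k ∈ Finset.Icc 1 n, ∀ r : ℝ, 0 < r →
      CircleIntegrable (fun z => Real.log (1 / HoloCurve.flatDist A k (f z))) 0 r) ∧
    ∃ (S : ℝ → ℝ) (E : Set ℝ), volume E < ⊤ ∧
      S =o[atTop ⊓ 𝓟 Eᶜ] HoloCurve.characteristic F ∧
      ∀ r : ℝ, 0 < r →
        ∑ k ∈ Finset.Icc 1 n, HoloCurve.flatProximity A k f r
            + HoloCurve.ramificationCounting F r
          ≤ (n + 1) * HoloCurve.characteristic F r + S r := by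
  classical
  refine ⟨fun k hk r _ => hF.circleIntegrable_log_flatDist A (Finset.mem_Icc.mp hk).2 r, ?_⟩
  set R : ℝ → ℝ := fun r => ∑ k ∈ Finset.Icc 1 n, HoloCurve.flatProximity A k f r +
    HoloCurve.ramificationCounting F r - (n + 1) * HoloCurve.characteristic F r with hR
  suffices h : ∃ E : Set ℝ, volume E < ⊤ ∧
      (fun r => max 0 (R r)) =o[atTop ⊓ 𝓟 Eᶜ] HoloCurve.characteristic F by
    obtain ⟨E, hE, hS⟩ := h
    -- `S` is the positive part of the defect of the inequality, which then holds for every `r > 0`;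
    -- only the asymptotics remain.
    refine ⟨fun r => max 0 (R r), E, hE, hS, fun r _ => ?_⟩
    have := le_max_right 0 (R r)
    simp only [hR] at this ⊢
    linarith
  -- For `n = 0` the characteristic is not unbounded, so constants would not be negligible. Here `W`
  -- is the only coordinate, and Jensen's formula gives equality with error `0`.
  rcases Nat.eq_zero_or_pos n with rfl | hn
  · refine ⟨∅, by simp, ?_⟩
    refine (isLittleO_zero _ _).congr' ?_ EventuallyEq.rfl
    refine (eventually_gt_atTop 0).filter_mono inf_le_left |>.mono fun r hr => ?_
    have hW : HoloCurve.wronskian F = fun z => F z 0 := by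
      funext z
      simp [HoloCurve.wronskian]
    have hnorm : ∀ z, ‖F z‖ = ‖HoloCurve.wronskian F z‖ := fun z => by
      rw [hW, EuclideanSpace.norm_eq]
      simp
    have hWd := HoloCurve.differentiable_wronskian hF.entire
    have hJ := HoloCurve.circleAverage_log_norm_of_differentiable hWd hr.ne'
    have hW0 : HoloCurve.wronskian F 0 ≠ 0 := by
      rw [← norm_ne_zero_iff, ← hnorm]
      exact norm_ne_zero_iff.mpr (hF.no_common_zero 0)
    rw [(hWd.analyticAt 0).meromorphicTrailingCoeffAt_of_ne_zero hW0] at hJ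
    simp [hR, HoloCurve.characteristic, HoloCurve.ramificationCounting, hnorm, hJ]
  choose! ν hν1 hν using fun a (ha : a ∈ A) => HoloCurve.exists_unit_normal (hA a ha)
  -- Any unit vector serves as the common denominator; it need not be a normal of a member of `A`.
  obtain ⟨w, hw⟩ : ∃ w : HoloCurve.HomCoord n, ‖w‖ = 1 :=
    ⟨EuclideanSpace.single 0 1, by simp⟩
  have hw0 : w ≠ 0 := norm_ne_zero_iff.mp (by rw [hw]; exact one_ne_zero)
  have hν0 : ∀ a ∈ A, ν a ≠ 0 := fun a ha =>
    norm_ne_zero_iff.mp (by rw [hν1 a ha]; exact one_ne_zero)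
  set h : Submodule ℂ (HoloCurve.HomCoord n) → ℂ → ℂ := fun a z =>
    inner ℂ (ν a) (F z) / inner ℂ w (F z) with hh
  have hT := HoloCurve.tendsto_characteristic hF hnd hn
  have hmer : ∀ v : HoloCurve.HomCoord n, Meromorphic fun z => inner ℂ v (F z) := fun v z =>
    ((hF.differentiable_inner v).analyticAt z).meromorphicAt
  have hord : ∀ v : HoloCurve.HomCoord n, v ≠ 0 →
      ∀ z, meromorphicOrderAt (fun z => inner ℂ v (F z)) z ≠ ⊤ := fun v hv =>
    HoloCurve.meromorphicOrderAt_ne_top_of_differentiable (hF.differentiable_inner v)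
      (hnd.exists_inner_ne_zero hv)
  have hconst : ∀ c : ℝ, (fun _ => c) =o[atTop] HoloCurve.characteristic F := fun c =>
    isLittleO_const_left.mpr (Or.inr (tendsto_norm_atTop_atTop.comp hT))
  have hdom : (fun r => ∑ a ∈ A, ValueDistribution.characteristic (h a) ⊤ r)
      =O[atTop] HoloCurve.characteristic F := by
    refine IsBigO.fun_sum fun a ha => ?_
    obtain ⟨C, hC⟩ := HoloCurve.exists_characteristic_div_le hF hnd (hν1 a ha) hw
    refine IsBigO.trans (g := fun r => HoloCurve.characteristic F r + C) ?_
      ((isBigO_refl _ _).add (hconst C).isBigO)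
    refine IsBigO.of_bound 1 ?_
    filter_upwards [eventually_ge_atTop 1] with r hr
    have h0 := ValueDistribution.characteristic_nonneg (f := h a) (a := ⊤) hr
    rw [one_mul, Real.norm_of_nonneg h0]
    exact (hC r hr).trans (le_abs_self _)
  obtain ⟨E, hE, hlog⟩ := HoloCurve.exists_isLittleO_circleAverage_posLog_iteratedDeriv A h
    (fun a _ => (hmer (ν a)).div (hmer w)) (fun a ha z => by
      have : h a = (fun z => inner ℂ (ν a) (F z)) * (fun z => inner ℂ w (F z))⁻¹ := by
        funext z
        simp [hh, div_eq_mul_inv]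
      rw [this, meromorphicOrderAt_mul (hmer _ z) (hmer w z).inv, meromorphicOrderAt_inv]
      simpa using ⟨hord _ (hν0 a ha) z, hord w hw0 z⟩) hT hdom
  refine ⟨E, hE, ?_⟩
  obtain ⟨C, hC⟩ := HoloCurve.exists_sum_flatProximity_add_ramificationCounting_le hF hnd hν hν1
    hcomplete hw0
  have herr : (fun r => C + (n + 1) * ∑ a ∈ A, ∑ i ∈ Finset.range (n + 1),
      Real.circleAverage (fun z => Real.posLog ‖iteratedDeriv i (h a) z / h a z‖) 0 r)
      =o[atTop ⊓ 𝓟 Eᶜ] HoloCurve.characteristic F :=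
    ((hconst C).mono inf_le_left).add (IsLittleO.const_mul_left
      (IsLittleO.fun_sum fun a ha => IsLittleO.fun_sum fun i _ => hlog a ha i) _)
  refine IsBigO.trans_isLittleO (IsBigO.of_bound 1 ?_) herr
  refine (eventually_gt_atTop 0).filter_mono inf_le_left |>.mono fun r hr => ?_
  rw [one_mul, Real.norm_of_nonneg (le_max_left _ _)]
  refine max_le (norm_nonneg _) (le_trans ?_ (le_abs_self _))
  have := hC r hr.ne'
  simp only [hR, hh]
  linarith
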